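/- Let $N\ge 1$, $m>0$, and consider in one space dimension the Klein–Gordon system with equal masses $$(\partial_t^2-\partial_x^2+m^2)u_j=F_j(u,\partial_t u,\partial_x u),\qquad j=1,\dots,N, \qquad (1)$$ for an $\mathbb R^N$-valued unknown $u=(u_j)_{1\le j\le N}$. Let $F:\mathbb R^N\times\mathbb R^N\times\mathbb R^N\to\mathbb R^N$ be of class $C^2$, and three times differentiable away from the origin (for instance of class $C^3$), and suppose that there is a constant $C_F$ such that $$|\partial^\alpha_{\zeta,\eta,\theta}F(\zeta,\eta,\theta)|\le C_F\,(|\zeta|^2+|\eta|^2+|\theta|^2)^{\frac{3-|\alpha|}2}\qquad\text{for all } 0\le|\alpha|\le 3$$ and all $(\zeta,\eta,\theta)$ (with $(\zeta,\eta,\theta)\neq 0$ if $|\alpha|=3$). With $\langle\partial_x\rangle=(m^2-\partial_x^2)^{1/2}$ (a Fourier multiplier), an $H^2\times H^1$-solution of (1) on an interval $I$ is a function $u\in C(I;H^2(\mathbb R)^N)\cap C^1(I;H^1(\mathbb R)^N)$ such that for all $t_0,t\in I$ and all $j$ $$u_j(t)=\cos(\langle\partial_x\rangle(t-t_0))u_j(t_0)+\langle\partial_x\rangle^{-1}\sin(\langle\partial_x\rangle(t-t_0))\,\partial_tu_j(t_0)+\int_{t_0}^t\langle\partial_x\rangle^{-1}\sin(\langle\partial_x\rangle(t-s))F_j(s)\,ds,$$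 $$\partial_tu_j(t)=-\langle\partial_x\rangle\sin(\langle\partial_x\rangle(t-t_0))u_j(t_0)+\cos(\langle\partial_x\rangle(t-t_0))\,\partial_tu_j(t_0)+\int_{t_0}^t\cos(\langle\partial_x\rangle(t-s))F_j(s)\,ds,$$ where $F_j(s)=F_j(u(s),\partial_tu(s),\partial_xu(s))$. Let $T\in\mathbb R$ and let $u$ be an $H^2\times H^1$-solution of (1) on $[T,\infty)$. Suppose that there are constants $C>0$ and $T_1>1$, $T_1\ge T$, such that $$\|u(t,\cdot)\|_{L^\infty}+\|\partial_xu(t,\cdot)\|_{L^\infty}\le C\,t^{-1/2}(\log t)^{-1/2}\qquad\text{for all }t\ge T_1,$$ and that for every $\varepsilon>0$ there is $T_2\ge T_1$ such that $$\|\partial_tu(t,\cdot)\|_{L^\infty}\le\varepsilon\,t^{-1/2}(\log t)^{-1/2}\qquad\text{for all }t\ge T_2.$$ Then $u$ is identically zero, i.e. $u(t)=0$ for all $t\in[T,\infty)$. -/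

import Mathlib

open MeasureTheory Set
open scoped FourierTransform ENNReal SchwartzMap

noncomputable section

namespace KleinGordon

/-- `ℝ^N` with its Euclidean norm. -/
abbrev Vec (N : ℕ) : Type := EuclideanSpace ℝ (Fin N)

/-- `L²(ℝ; ℝ^N)`. -/
abbrev L2 (N : ℕ) : Type := Lp (Vec N) 2 (volume : Measure ℝ)

/-- `L²(ℝ; ℂ)`. -/
abbrev L2C : Type := Lp ℂ 2 (volume : Measure ℝ)

/-- The `j`-th component `f_j` of `f ∈ L²(ℝ; ℝ^N)`, regarded as a complex-valued function. -/
def comp {N : ℕ} (j : Fin N) : L2 N →L[ℝ] L2C :=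
  (Complex.ofRealCLM.comp (EuclideanSpace.proj j : Vec N →L[ℝ] ℝ)).compLpL 2 volume

/-- `g = ∂ₓ f` in the sense of (tempered) distributions, component by component. -/
def IsWeakDeriv {N : ℕ} (f g : L2 N) : Prop :=
  ∀ j : Fin N, TemperedDistribution.derivCLM ℂ (comp j f : 𝓢'(ℝ, ℂ)) = (comp j g : 𝓢'(ℝ, ℂ))

theorem IsWeakDeriv.zero {N : ℕ} : IsWeakDeriv (0 : L2 N) 0 := by
  intro j
  simp only [map_zero, ← Lp.toTemperedDistributionCLM_apply]

theorem IsWeakDeriv.add {N : ℕ} {f g f' g' : L2 N} (h : IsWeakDeriv f g)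
    (h' : IsWeakDeriv f' g') : IsWeakDeriv (f + f') (g + g') := by
  intro j
  have e := h j
  have e' := h' j
  simp only [map_add, ← Lp.toTemperedDistributionCLM_apply] at e e' ⊢
  rw [e, e']

theorem comp_smul {N : ℕ} (j : Fin N) (c : ℝ) (f : L2 N) :
    comp j (c • f) = (c : ℂ) • comp j f := by
  rw [map_smul]
  exact RCLike.real_smul_eq_coe_smul (K := ℂ) c (comp j f)

theorem IsWeakDeriv.smul {N : ℕ} (c : ℝ) {f g : L2 N} (h : IsWeakDeriv f g) :
    IsWeakDeriv (c • f) (c • g) := by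
  intro j
  have e := h j
  simp only [← Lp.toTemperedDistributionCLM_apply] at e ⊢
  rw [comp_smul, comp_smul, map_smul, map_smul, map_smul, e]

/-- The Sobolev space `H^k(ℝ; ℝ^N)`. A function `f` is represented by the family
`(f, ∂ₓ f, …, ∂ₓ^k f)` of its weak derivatives, all in `L²`; the norm is the usual one,
`‖f‖² = ∑_{i ≤ k} ‖∂ₓ^i f‖²_{L²}`. -/
def Sobolev (N k : ℕ) : Submodule ℝ (PiLp 2 fun _ : Fin (k + 1) => L2 N) where
  carrier := {f | ∀ i : Fin k, IsWeakDeriv (f i.castSucc) (f i.succ)}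
  zero_mem' := fun _ => IsWeakDeriv.zero
  add_mem' := fun hf hg i => (hf i).add (hg i)
  smul_mem' := fun c _ hf i => (hf i).smul c

/-- The `i`-th weak derivative `∂ₓ^i f`, `i ≤ k`, of `f ∈ H^k(ℝ; ℝ^N)`. -/
def der {N k : ℕ} (i : Fin (k + 1)) (f : Sobolev N k) : L2 N := f.1 i

/-- The inclusion `H^{k+1} ⊆ H^k`: it forgets the last derivative. -/
def incl {N k : ℕ} (f : Sobolev N (k + 1)) : Sobolev N k :=
  ⟨WithLp.toLp 2 fun i : Fin (k + 1) => f.1 i.castSucc, fun i => f.2 i.castSucc⟩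

/-- The time derivative `∂ₜ u(t) ∈ H¹` of a curve `u` in `H²`, taken within the interval `I` of
existence, as a limit of difference quotients in `H¹`. -/
def timeDeriv {N : ℕ} (I : Set ℝ) (u : ℝ → Sobolev N 2) (t : ℝ) : Sobolev N 1 :=
  derivWithin (fun s => incl (u s)) I t

/-- The symbol `⟨ξ⟩ = (m² + (2πξ)²)^{1/2}` of the operator `⟨∂ₓ⟩ = (m² - ∂ₓ²)^{1/2}`
(with Mathlib's Fourier transform, `∂ₓ` has the symbol `2πiξ`). -/
def symb (m ξ : ℝ) : ℝ := √(m ^ 2 + (2 * Real.pi * ξ) ^ 2)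

open Classical in
/-- The Fourier multiplier `f ↦ 𝓕⁻¹ (a 𝓕 f)` on `L²(ℝ; ℂ)` with symbol `a`, on its natural
domain `{f ∈ L² | a 𝓕 f ∈ L²}`, extended by `0`. This domain is all of `L²` if `a` is bounded and
measurable, and it contains `H¹` if `a` is measurable and `|a| ≤ c ⟨ξ⟩`. -/
def fourierMul (a : ℝ → ℝ) (f : L2C) : L2C :=
  if h : MemLp (fun ξ => (a ξ : ℂ) * (𝓕 f : L2C) ξ) 2 volume then 𝓕⁻ (h.toLp : L2C) else 0

/-- `cos(τ⟨∂ₓ⟩)`. -/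
def cosOp (m τ : ℝ) : L2C → L2C := fourierMul fun ξ => Real.cos (symb m ξ * τ)

/-- `⟨∂ₓ⟩⁻¹ sin(τ⟨∂ₓ⟩)`. -/
def invSinOp (m τ : ℝ) : L2C → L2C := fourierMul fun ξ => (symb m ξ)⁻¹ * Real.sin (symb m ξ * τ)

/-- `⟨∂ₓ⟩ sin(τ⟨∂ₓ⟩)`. -/
def mulSinOp (m τ : ℝ) : L2C → L2C := fourierMul fun ξ => symb m ξ * Real.sin (symb m ξ * τ)

open Classical in
/-- The function `x ↦ F(ζ(x), η(x), θ(x))` as an element of `L²(ℝ; ℝ^N)`. (For the cubic `F` below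
it does belong to `L²` if `ζ ∈ H²`, `η ∈ H¹` and `θ = ∂ₓ ζ`.) -/
def nemytskii {N : ℕ} (F : Vec N × Vec N × Vec N → Vec N) (ζ η θ : L2 N) : L2 N :=
  if h : MemLp (fun x => F (ζ x, η x, θ x)) 2 volume then h.toLp else 0

/-- `F(u(s), ∂ₜ u(s), ∂ₓ u(s))`. -/
def forcing {N : ℕ} (F : Vec N × Vec N × Vec N → Vec N) (I : Set ℝ) (u : ℝ → Sobolev N 2)
    (s : ℝ) : L2 N :=
  nemytskii F (der 0 (u s)) (der 0 (timeDeriv I u s)) (der 1 (u s))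

/-- `u` is an `H² × H¹`-solution on the interval `I` of the system
`(∂ₜ² - ∂ₓ² + m²) u_j = F_j(u, ∂ₜ u, ∂ₓ u)`, `1 ≤ j ≤ N`: it lies in `C(I; H²) ∩ C¹(I; H¹)` and obeys
the Duhamel formula, whose two rows are the last two fields (integrals are `L²`-valued). -/
structure IsSolution {N : ℕ} (F : Vec N × Vec N × Vec N → Vec N) (m : ℝ) (I : Set ℝ)
    (u : ℝ → Sobolev N 2) : Prop where
  continuousOn : ContinuousOn u I
  contDiffOn : ContDiffOn ℝ 1 (fun t => incl (u t)) I
  duhamel : ∀ t₀ ∈ I, ∀ t ∈ I, ∀ j : Fin N,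
    comp j (der 0 (u t)) =
      cosOp m (t - t₀) (comp j (der 0 (u t₀)))
        + invSinOp m (t - t₀) (comp j (der 0 (timeDeriv I u t₀)))
        + ∫ s in t₀..t, invSinOp m (t - s) (comp j (forcing F I u s))
  duhamel_deriv : ∀ t₀ ∈ I, ∀ t ∈ I, ∀ j : Fin N,
    comp j (der 0 (timeDeriv I u t)) =
      - mulSinOp m (t - t₀) (comp j (der 0 (u t₀)))
        + cosOp m (t - t₀) (comp j (der 0 (timeDeriv I u t₀)))
        + ∫ s in t₀..t, cosOp m (t - s) (comp j (forcing F I u s))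

/-- The coordinate directions of `ℝ^N × ℝ^N × ℝ^N`: the `j`-th one of the `i`-th factor. -/
def coordDir {N : ℕ} (i : Fin 3 × Fin N) : Vec N × Vec N × Vec N :=
  (![(EuclideanSpace.single i.2 1, 0, 0), (0, EuclideanSpace.single i.2 1, 0),
    (0, 0, EuclideanSpace.single i.2 1)] : Fin 3 → Vec N × Vec N × Vec N) i.1

/-- The nonlinearity `F` is `C²`, three times differentiable away from the origin (in particular,
every `C³` map qualifies), and
`|∂^α F(ζ, η, θ)| ≤ C (|ζ|² + |η|² + |θ|²)^{(3 - |α|)/2}` for all partial derivatives of order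
`|α| = k ≤ 3`. -/
structure IsCubic {N : ℕ} (F : Vec N × Vec N × Vec N → Vec N) : Prop where
  contDiff : ContDiff ℝ 2 F
  differentiableAt : ∀ p ≠ 0, DifferentiableAt ℝ (iteratedFDeriv ℝ 2 F) p
  bound : ∃ C : ℝ, ∀ k ≤ 3, ∀ α : Fin k → Fin 3 × Fin N, ∀ ζ η θ : Vec N,
    (ζ, η, θ) ≠ 0 ∨ k < 3 →
    ‖iteratedFDeriv ℝ k F (ζ, η, θ) (fun i => coordDir (α i))‖
      ≤ C * (‖ζ‖ ^ 2 + ‖η‖ ^ 2 + ‖θ‖ ^ 2) ^ ((3 - k : ℝ) / 2)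

/-- The norm of `L^∞(ℝ; ℝ^N)`, with values in `[0, ∞]`. -/
def supNorm {N : ℕ} (f : L2 N) : ℝ≥0∞ := eLpNorm f ∞ volume

end KleinGordon

end

/-!
The energy of a solution is localized to the light cone by the weight
`w(t, x) = step (t - √(1 + x²))`, whose level sets move outwards at least at the speed of light:
`|∂ₓ w| ≤ ∂ₜ w` (`abs_weightSpace_le`). In the derivative of
`E(t) = ∫ w (|∂ₜ u|² + |∂ₓ u|² + m² |u|²) dx` the flux through the moving weight therefore has a good
sign, and only the work of the nonlinearity remains. As `F` is cubic, that work is at least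
`-K ‖∂ₜ u‖_∞ (‖u‖_∞ + ‖∂ₜ u‖_∞ + ‖∂ₓ u‖_∞) E` (`IsSolution.exists_solEnergy_deriv_ge`).

Under the decay assumptions the coefficient of `E` is at most `1 / (2 t log t)` for large `t`, because
one of its factors is `∂ₜ u`, which is small compared with `(t log t)^{-1/2}`. So `E(t) (log t)^{1/2}` is
nondecreasing. On the other hand `∫ w dx` is `O(t)`, and the pointwise decay of `u`, `∂ₜ u`, `∂ₓ u`
gives `E(t) = O(1 / log t)`. Both together force `E = 0` at large times
(`solEnergy_nonpos_of_decay`). The same inequality with locally bounded coefficients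
propagates this back to the initial time (`IsSolution.solEnergy_nonpos_of_le`), and `w > 0` makes `u`
vanish. No compact support is needed, since the weight is integrable in space.

The differentiation of `E` rests on the equation `∂ₜ² u = ∂ₓ² u - m² u + F` in `L²`, obtained by
differentiating the Duhamel formula at its base point (`IsSolution.hasDerivWithinAt_timeDeriv`), and
on integration by parts in `H¹`, which is Plancherel's theorem (`HasWeakDeriv.inner_eq`).
-/

noncomputable section

namespace KleinGordon

open Filter Topology
open scoped BoundedContinuousFunction NNReal

variable {N : ℕ}

/-! ### Weak derivatives and the Fourier transform -/

/-- `g` is the distributional derivative of `f`, for complex-valued `L²` functions: the scalar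
counterpart of `IsWeakDeriv`. -/
def HasWeakDeriv (f g : L2C) : Prop :=
  TemperedDistribution.derivCLM ℂ (f : 𝓢'(ℝ, ℂ)) = (g : 𝓢'(ℝ, ℂ))

theorem HasWeakDeriv.integral_eq {f g : L2C} (h : HasWeakDeriv f g) (φ : 𝓢(ℝ, ℂ)) :
    ∫ x, deriv φ x * f x = - ∫ x, φ x * g x := by
  have := DFunLike.congr_fun h φ
  simp only [TemperedDistribution.derivCLM_apply_apply, map_neg,
    Lp.toTemperedDistribution_apply, SchwartzMap.derivCLM_apply, smul_eq_mul] at this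
  rw [← this, neg_neg]

theorem hasWeakDeriv_iff {f g : L2C} : HasWeakDeriv f g ↔
    ∀ φ : 𝓢(ℝ, ℂ), ∫ x, deriv φ x * f x = - ∫ x, φ x * g x := by
  refine ⟨fun h => h.integral_eq, fun h => ?_⟩
  ext φ
  simp only [TemperedDistribution.derivCLM_apply_apply, map_neg,
    Lp.toTemperedDistribution_apply, SchwartzMap.derivCLM_apply, smul_eq_mul]
  rw [h, neg_neg]

theorem ae_eq_of_integral_schwartz {f g : ℝ → ℂ} (hf : LocallyIntegrable f)
    (hg : LocallyIntegrable g) (h : ∀ φ : 𝓢(ℝ, ℂ), ∫ x, φ x * f x = ∫ x, φ x * g x) :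
    f =ᵐ[volume] g := by
  refine ae_eq_of_integral_contDiff_smul_eq hf hg fun χ hχ hc => ?_
  have hg₁ : HasCompactSupport (Complex.ofRealCLM ∘ χ) := hc.comp_left rfl
  have hg₂ : ContDiff ℝ ((⊤ : ℕ∞) : WithTop ℕ∞) (Complex.ofRealCLM ∘ χ) := by fun_prop
  simpa using h (hg₁.toSchwartzMap hg₂)

theorem HasWeakDeriv.fourier {f g : L2C} (h : HasWeakDeriv f g) :
    (𝓕 g : L2C) =ᵐ[volume] fun ξ => (2 * Real.pi * ξ * Complex.I : ℂ) * (𝓕 f : L2C) ξ := by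
  have hgrow : (fun ξ : ℝ => (2 * Real.pi * ξ * Complex.I : ℂ)).HasTemperateGrowth := by
    fun_prop
  have key : (Lp.toTemperedDistribution (𝓕 g : L2C) : 𝓢'(ℝ, ℂ)) =
      TemperedDistribution.smulLeftCLM ℂ (fun ξ : ℝ => (2 * Real.pi * ξ * Complex.I : ℂ))
        (Lp.toTemperedDistribution (𝓕 f : L2C)) := by
    rw [← Lp.fourier_toTemperedDistribution_eq, ← Lp.fourier_toTemperedDistribution_eq, ← h]
    have e : TemperedDistribution.derivCLM ℂ (f : 𝓢'(ℝ, ℂ)) =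
        LineDeriv.lineDerivOp (1 : ℝ) (f : 𝓢'(ℝ, ℂ)) := by
      ext φ
      rw [TemperedDistribution.derivCLM_apply_apply, TemperedDistribution.lineDerivOp_apply_apply]
      congr 2
    rw [e, TemperedDistribution.fourier_lineDerivOp_eq]
    have e2 : (fun ξ : ℝ => (2 * Real.pi * ξ * Complex.I : ℂ)) =
      (2 * Real.pi * Complex.I : ℂ) • (fun ξ : ℝ => ((inner ℝ ξ (1:ℝ) : ℝ) : ℂ)) := by
      ext ξ; simp; ring
    rw [e2, TemperedDistribution.smulLeftCLM_smul (by fun_prop)]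
    rfl
  refine ae_eq_of_integral_schwartz ((Lp.memLp _).locallyIntegrable (by norm_num)) ?_ ?_
  · have hc : Continuous fun ξ : ℝ => (2 * Real.pi * ξ * Complex.I : ℂ) := by fun_prop
    simpa using ((Lp.memLp (𝓕 f : L2C)).locallyIntegrable (by norm_num)).continuous_smul hc
  · intro φ
    have := DFunLike.congr_fun key φ
    rw [TemperedDistribution.smulLeftCLM_apply_apply, Lp.toTemperedDistribution_apply,
      Lp.toTemperedDistribution_apply] at this
    simp only [SchwartzMap.smulLeftCLM_apply_apply hgrow, smul_eq_mul] at this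
    rw [this]
    congr 1; ext x; ring

/-- Integration by parts in `L²`; on the Fourier side both inner products are the same integral up to
a sign, because the symbol `2πiξ` is purely imaginary. -/
theorem HasWeakDeriv.inner_eq {f f' g g' : L2C} (hf : HasWeakDeriv f f') (hg : HasWeakDeriv g g') :
    inner ℂ f' g = - inner ℂ f g' := by
  rw [← Lp.inner_fourier_eq f', ← Lp.inner_fourier_eq f, L2.inner_def, L2.inner_def, ← integral_neg]
  refine integral_congr_ae ?_
  filter_upwards [hf.fourier, hg.fourier] with ξ h1 h2
  simp only [h1, h2, RCLike.inner_apply, map_mul, Complex.conj_I, Complex.conj_ofReal, map_ofNat]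
  ring

theorem L2C_norm_sq_eq_integral (f : L2C) : ‖f‖ ^ 2 = ∫ x, ‖f x‖ ^ 2 := by
  have h := inner_self_eq_norm_sq_to_K (𝕜 := ℂ) f
  rw [L2.inner_def] at h
  simp only [inner_self_eq_norm_sq_to_K] at h
  have h2 : ((∫ x, ‖f x‖ ^ 2 : ℝ) : ℂ) = ((‖f‖ ^ 2 : ℝ) : ℂ) := by
    rw [← integral_complex_ofReal]; push_cast; exact h
  exact_mod_cast h2.symm

/-- An `L²` function with integrable Fourier transform is bounded, since it agrees almost everywhere
with the inverse Fourier integral of its transform. -/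
theorem ae_norm_le_integral_fourier {f : L2C} (hi : Integrable (𝓕 f : L2C)) :
    ∀ᵐ x, ‖f x‖ ≤ ∫ ξ, ‖(𝓕 f : L2C) ξ‖ := by
  have hn : ∀ x, ‖𝓕⁻ ((𝓕 f : L2C) : ℝ → ℂ) x‖ ≤ ∫ ξ, ‖(𝓕 f : L2C) ξ‖ := fun x => by
    rw [Real.fourierInv_eq]
    refine (norm_integral_le_integral_norm _).trans_eq ?_
    simp
  have hcont : Continuous (𝓕⁻ ((𝓕 f : L2C) : ℝ → ℂ)) := by
    exact VectorFourier.fourierIntegral_continuous Real.continuous_fourierChar (L := -(innerₗ ℝ))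
      (by simp only [LinearMap.neg_apply, innerₗ_apply_apply]; fun_prop) hi
  have : f =ᵐ[volume] 𝓕⁻ ((𝓕 f : L2C) : ℝ → ℂ) := by
    refine ae_eq_of_integral_schwartz ((Lp.memLp _).locallyIntegrable (by norm_num))
      hcont.locallyIntegrable fun φ => ?_
    have h1 : (Lp.toTemperedDistribution f : 𝓢'(ℝ, ℂ)) φ =
        (Lp.toTemperedDistribution (𝓕 f : L2C) : 𝓢'(ℝ, ℂ)) (𝓕⁻ φ) := by
      rw [← Lp.fourier_toTemperedDistribution_eq, TemperedDistribution.fourier_apply]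
      simp
    simp only [Lp.toTemperedDistribution_apply, smul_eq_mul] at h1
    rw [h1]
    have h2 := VectorFourier.integral_fourierIntegral_smul_eq_flip (e := Real.fourierChar) (μ := volume)
      (ν := volume) (L := -(innerₗ ℝ)) (f := φ) (g := ((𝓕 f : L2C) : ℝ → ℂ)) Real.continuous_fourierChar
      (by simp only [LinearMap.neg_apply, innerₗ_apply_apply]; fun_prop) φ.integrable hi
    have e : (-(innerₗ ℝ)).flip = (-(innerₗ ℝ) : ℝ →ₗ[ℝ] ℝ →ₗ[ℝ] ℝ) := by
      ext; simp
    rw [e] at h2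
    rw [SchwartzMap.fourierInv_coe]
    exact h2
  filter_upwards [this] with x hx
  rw [hx]; exact hn x

/-- A non-homogeneous form of the Sobolev embedding `H¹(ℝ) ⊆ L^∞(ℝ)`; it comes from
`2|f̂| ≤ (1 + ξ²)⁻¹ + (1 + ξ²)|f̂|²`. -/
theorem HasWeakDeriv.ae_norm_le {f g : L2C} (h : HasWeakDeriv f g) :
    ∀ᵐ x, ‖f x‖ ≤ 2 + ‖f‖ ^ 2 + ‖g‖ ^ 2 := by
  have e1 : Integrable fun ξ => ‖(𝓕 f : L2C) ξ‖ ^ 2 :=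
    (Lp.memLp (𝓕 f : L2C)).integrable_norm_pow (by norm_num)
  have e2 : Integrable fun ξ => ‖(𝓕 g : L2C) ξ‖ ^ 2 :=
    (Lp.memLp (𝓕 g : L2C)).integrable_norm_pow (by norm_num)
  have e3 : Integrable fun ξ : ℝ => (1 + ξ ^ 2)⁻¹ := integrable_inv_one_add_sq
  have e4 := ((e3.add (e1.add e2)).const_mul (1 / 2))
  have hb : ∀ᵐ ξ, ‖(𝓕 f : L2C) ξ‖ ≤ 1 / 2 * ((1 + ξ ^ 2)⁻¹ + (‖(𝓕 f : L2C) ξ‖ ^ 2 + ‖(𝓕 g : L2C) ξ‖ ^ 2)) := by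
    filter_upwards [h.fourier] with ξ hξ
    have h1 : ‖(𝓕 g : L2C) ξ‖ = 2 * Real.pi * |ξ| * ‖(𝓕 f : L2C) ξ‖ := by
      rw [hξ]; simp [abs_of_pos Real.pi_pos]
    set z := ‖(𝓕 f : L2C) ξ‖
    have h2 : ξ ^ 2 * z ^ 2 ≤ ‖(𝓕 g : L2C) ξ‖ ^ 2 := by
      rw [h1, mul_pow, mul_pow, sq_abs]
      have : (1:ℝ) ≤ (2 * Real.pi) ^ 2 := by nlinarith [Real.pi_gt_three]
      nlinarith [mul_nonneg (sq_nonneg ξ) (sq_nonneg z)]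
    have h3 : 0 < 1 + ξ ^ 2 := by positivity
    have h4 : 2 * z ≤ (1 + ξ ^ 2)⁻¹ + (1 + ξ ^ 2) * z ^ 2 := by
      have := mul_nonneg (inv_nonneg.2 h3.le) (sq_nonneg ((1 + ξ ^ 2) * z - 1))
      have e : (1 + ξ ^ 2)⁻¹ * ((1 + ξ ^ 2) * z - 1) ^ 2 = (1 + ξ ^ 2) * z ^ 2 - 2 * z + (1 + ξ ^ 2)⁻¹ := by
        field_simp; ring
      linarith
    linarith
  have hi : Integrable (𝓕 f : L2C) := by
    refine e4.mono' (Lp.aestronglyMeasurable _) ?_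
    simpa using hb
  filter_upwards [ae_norm_le_integral_fourier hi] with x hx
  refine hx.trans ((integral_mono_ae hi.norm e4 hb).trans ?_)
  have n1 : ∫ ξ, ‖(𝓕 f : L2C) ξ‖ ^ 2 = ‖f‖ ^ 2 := by
    rw [← Lp.norm_fourier_eq f, L2C_norm_sq_eq_integral]
  have n2 : ∫ ξ, ‖(𝓕 g : L2C) ξ‖ ^ 2 = ‖g‖ ^ 2 := by
    rw [← Lp.norm_fourier_eq g, L2C_norm_sq_eq_integral]
  rw [integral_const_mul]
  rw [integral_add' e3 (e1.add e2), integral_add' e1 e2, n1, n2, integral_univ_inv_one_add_sq]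
  nlinarith [Real.pi_lt_d2, sq_nonneg ‖f‖, sq_nonneg ‖g‖]

/-! ### The propagators of the Klein–Gordon equation -/

/-- Dominated convergence to zero in `L²`. The representatives `G i` are kept apart from the classes
`g i`, because an uncountable family has no common null set. -/
theorem tendsto_zero_of_dominated {ι : Type*} {l : Filter ι} [l.IsCountablyGenerated]
    {g : ι → L2C} {G : ι → ℝ → ℂ} {B : ℝ → ℝ} (hg : ∀ i, g i =ᵐ[volume] G i)
    (hB : MemLp B 2) (hb : ∀ᶠ i in l, ∀ᵐ x, ‖G i x‖ ≤ B x)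
    (hlim : ∀ᵐ x, Tendsto (fun i => G i x) l (𝓝 0)) : Tendsto g l (𝓝 0) := by
  rw [tendsto_zero_iff_norm_tendsto_zero]
  have key : Tendsto (fun i => ‖g i‖ ^ 2) l (𝓝 0) := by
    have e : ∀ i, ‖g i‖ ^ 2 = ∫ x, ‖G i x‖ ^ 2 := fun i => by
      rw [L2C_norm_sq_eq_integral]
      exact integral_congr_ae ((hg i).mono fun x hx => by simp only [hx])
    simp only [e]
    have := tendsto_integral_filter_of_dominated_convergence (μ := volume) (l := l)
      (F := fun i x => ‖G i x‖ ^ 2) (f := fun _ => (0 : ℝ)) (fun x => B x ^ 2) ?_ ?_ ?_ ?_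
    · simpa using this
    · filter_upwards with i
      have : AEStronglyMeasurable (G i) volume := (Lp.aestronglyMeasurable (g i)).congr (hg i)
      exact this.norm.pow 2
    · filter_upwards [hb] with i hi
      filter_upwards [hi] with x hx
      rw [norm_pow, norm_norm]
      exact pow_le_pow_left₀ (norm_nonneg _) hx 2
    · exact hB.integrable_sq
    · filter_upwards [hlim] with x hx
      simpa using (hx.norm.pow 2)
  have := (Real.continuous_sqrt.tendsto 0).comp key
  simpa [Function.comp_def, Real.sqrt_sq (norm_nonneg _)] using this

theorem fourier_fourierMul {a : ℝ → ℝ} {f : L2C}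
    (h : MemLp (fun ξ => (a ξ : ℂ) * (𝓕 f : L2C) ξ) 2 volume) :
    (𝓕 (fourierMul a f) : L2C) =ᵐ[volume] fun ξ => (a ξ : ℂ) * (𝓕 f : L2C) ξ := by
  rw [fourierMul, dif_pos h, FourierInvPair.fourier_fourierInv_eq]
  exact h.coeFn_toLp

theorem memLp_mul_fourier {a B : ℝ → ℝ} (ha : Continuous a) {f : L2C}
    (hB : MemLp (fun ξ => B ξ * ‖(𝓕 f : L2C) ξ‖) 2 volume) (hab : ∀ ξ, |a ξ| ≤ B ξ) :
    MemLp (fun ξ => (a ξ : ℂ) * (𝓕 f : L2C) ξ) 2 volume := by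
  have : Continuous fun ξ => (a ξ : ℂ) := by fun_prop
  refine hB.of_le (this.aestronglyMeasurable.mul (Lp.aestronglyMeasurable _)) ?_
  filter_upwards with ξ
  rw [norm_mul, norm_mul, Complex.norm_real, norm_norm]
  gcongr
  exact (hab ξ).trans (le_abs_self _)

theorem memLp_mul_fourier_of_le_one {a : ℝ → ℝ} (ha : Continuous a) (f : L2C)
    (hab : ∀ ξ, |a ξ| ≤ 1) : MemLp (fun ξ => (a ξ : ℂ) * (𝓕 f : L2C) ξ) 2 volume :=
  memLp_mul_fourier (B := fun _ => 1) ha (by simpa using (Lp.memLp (𝓕 f : L2C)).norm) hab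

/-- A family of Fourier multipliers may be differentiated at `h = 0` under the multiplier if the
remainder of the symbols is dominated by `|h| B` with `B 𝓕 f ∈ L²`. -/
theorem hasDerivAt_fourierMul {a : ℝ → ℝ → ℝ} {a' B : ℝ → ℝ} {f d : L2C}
    (hmem : ∀ h, MemLp (fun ξ => (a h ξ : ℂ) * (𝓕 f : L2C) ξ) 2 volume)
    (hB : MemLp (fun ξ => B ξ * ‖(𝓕 f : L2C) ξ‖) 2 volume)
    (hab : ∀ h ξ, |a h ξ - a 0 ξ - h * a' ξ| ≤ |h| * B ξ)
    (ha : ∀ ξ, HasDerivAt (fun h => a h ξ) (a' ξ) 0)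
    (hd : (𝓕 d : L2C) =ᵐ[volume] fun ξ => (a' ξ : ℂ) * (𝓕 f : L2C) ξ) :
    HasDerivAt (fun h => fourierMul (a h) f) d 0 := by
  rw [hasDerivAt_iff_tendsto_slope_zero, ← tendsto_sub_nhds_zero_iff]
  have hF : Tendsto (fun t : ℝ => 𝓕 (t⁻¹ • (fourierMul (a (0 + t)) f - fourierMul (a 0) f) - d))
      (𝓝[≠] 0) (𝓝 0) := by
    refine tendsto_zero_of_dominated
      (G := fun t ξ => ((t⁻¹ * (a t ξ - a 0 ξ) - a' ξ : ℝ) : ℂ) * (𝓕 f : L2C) ξ) (fun t => ?_) hB ?_ ?_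
    · have e : 𝓕 (t⁻¹ • (fourierMul (a (0 + t)) f - fourierMul (a 0) f) - d) =
          (t⁻¹ : ℂ) • (𝓕 (fourierMul (a t) f) - 𝓕 (fourierMul (a 0) f)) - 𝓕 d := by
        change Lp.fourierTransformₗᵢ ℝ ℂ _ = (t⁻¹ : ℂ) • (Lp.fourierTransformₗᵢ ℝ ℂ _
          - Lp.fourierTransformₗᵢ ℝ ℂ _) - Lp.fourierTransformₗᵢ ℝ ℂ _
        rw [zero_add, map_sub, RCLike.real_smul_eq_coe_smul (K := ℂ), map_smul, map_sub]
        simp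
      rw [e]
      filter_upwards [Lp.coeFn_sub ((t⁻¹ : ℂ) • (𝓕 (fourierMul (a t) f) - 𝓕 (fourierMul (a 0) f))) (𝓕 d),
        Lp.coeFn_smul (t⁻¹ : ℂ) (𝓕 (fourierMul (a t) f) - 𝓕 (fourierMul (a 0) f)),
        Lp.coeFn_sub (𝓕 (fourierMul (a t) f)) (𝓕 (fourierMul (a 0) f)), hd,
        fourier_fourierMul (hmem t), fourier_fourierMul (hmem 0)] with ξ h1 h2 h3 h4 h5 h6
      rw [h1, Pi.sub_apply, h2, Pi.smul_apply, h3, Pi.sub_apply, h4, h5, h6]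
      push_cast
      simp only [smul_eq_mul]
      ring
    · filter_upwards [self_mem_nhdsWithin] with t ht
      filter_upwards with ξ
      rw [norm_mul, Complex.norm_real]
      gcongr
      have ht' : 0 < |t| := abs_pos.2 ht
      have e : t⁻¹ * (a t ξ - a 0 ξ) - a' ξ = t⁻¹ * (a t ξ - a 0 ξ - t * a' ξ) := by
        have : t ≠ 0 := ht
        field_simp
      rw [e, norm_mul, norm_inv, Real.norm_eq_abs, Real.norm_eq_abs, inv_mul_le_iff₀ ht']
      exact hab t ξ
    · filter_upwards with ξ
      have := (hasDerivAt_iff_tendsto_slope_zero.1 (ha ξ)).sub_const (a' ξ)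
      simp only [zero_add, sub_self, smul_eq_mul] at this
      have h2 := ((Complex.continuous_ofReal.tendsto 0).comp this).mul_const ((𝓕 f : L2C) ξ)
      simpa [Function.comp_def] using h2
  rw [tendsto_zero_iff_norm_tendsto_zero] at hF ⊢
  simpa only [Lp.norm_fourier_eq] using hF

theorem symb_continuous (m : ℝ) : Continuous (symb m) := by
  unfold symb; fun_prop

theorem symb_nonneg (m ξ : ℝ) : 0 ≤ symb m ξ := Real.sqrt_nonneg _

theorem symb_sq (m ξ : ℝ) : symb m ξ ^ 2 = m ^ 2 + (2 * Real.pi * ξ) ^ 2 :=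
  Real.sq_sqrt (by positivity)

theorem HasWeakDeriv.memLp_symb_mul {f g : L2C} (h : HasWeakDeriv f g) (m : ℝ) :
    MemLp (fun ξ => symb m ξ * ‖(𝓕 f : L2C) ξ‖) 2 volume := by
  have h1 : MemLp (fun ξ => |m| * ‖(𝓕 f : L2C) ξ‖ + ‖(𝓕 g : L2C) ξ‖) 2 volume :=
    ((Lp.memLp (𝓕 f : L2C)).norm.const_mul _).add (Lp.memLp (𝓕 g : L2C)).norm
  refine h1.of_le ((symb_continuous m).aestronglyMeasurable.mul (Lp.aestronglyMeasurable _).norm) ?_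
  filter_upwards [h.fourier] with ξ hξ
  have e : ‖(𝓕 g : L2C) ξ‖ = |2 * Real.pi * ξ| * ‖(𝓕 f : L2C) ξ‖ := by
    rw [hξ]; simp [abs_mul]
  rw [e, ← add_mul, norm_mul, norm_mul, norm_norm, Real.norm_of_nonneg (symb_nonneg m ξ)]
  gcongr
  refine (Real.sqrt_le_iff.2 ⟨by positivity, ?_⟩).trans (le_abs_self _)
  nlinarith [sq_abs m, sq_abs (2 * Real.pi * ξ), mul_nonneg (abs_nonneg m) (abs_nonneg (2 * Real.pi * ξ))]

/-- The operator `⟨∂ₓ⟩² = m² - ∂ₓ²` on the Fourier side. -/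
theorem fourier_sq_smul_sub {f g k : L2C} (h : HasWeakDeriv f g) (h' : HasWeakDeriv g k) (m : ℝ) :
    (𝓕 ((m ^ 2 : ℂ) • f - k) : L2C) =ᵐ[volume]
      fun ξ => ((symb m ξ ^ 2 : ℝ) : ℂ) * (𝓕 f : L2C) ξ := by
  have e : (𝓕 ((m ^ 2 : ℂ) • f - k) : L2C) = (m ^ 2 : ℂ) • 𝓕 f - 𝓕 k := by
    change Lp.fourierTransformₗᵢ ℝ ℂ _ = (m ^ 2 : ℂ) • Lp.fourierTransformₗᵢ ℝ ℂ _
      - Lp.fourierTransformₗᵢ ℝ ℂ _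
    rw [map_sub, map_smul]
  rw [e]
  filter_upwards [Lp.coeFn_sub ((m ^ 2 : ℂ) • 𝓕 f) (𝓕 k), Lp.coeFn_smul (m ^ 2 : ℂ) (𝓕 f : L2C),
    h.fourier, h'.fourier] with ξ h1 h2 h3 h4
  rw [h1, Pi.sub_apply, h2, Pi.smul_apply, h4, h3, symb_sq, smul_eq_mul]
  push_cast
  linear_combination (-(2 * Real.pi * ξ) ^ 2 * (𝓕 f : L2C) ξ : ℂ) * Complex.I_sq

theorem norm_cosOp_sub_le (m τ : ℝ) (f g : L2C) : ‖cosOp m τ f - cosOp m τ g‖ ≤ ‖f - g‖ := by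
  have hc : Continuous fun ξ => Real.cos (symb m ξ * τ) := by
    have := symb_continuous m; fun_prop
  have hm : ∀ f : L2C, MemLp (fun ξ => (Real.cos (symb m ξ * τ) : ℂ) * (𝓕 f : L2C) ξ) 2 volume :=
    fun f => memLp_mul_fourier_of_le_one hc f fun ξ => Real.abs_cos_le_one _
  have e : ∀ f g : L2C, 𝓕 (f - g) = 𝓕 f - 𝓕 g := (Lp.fourierTransformₗᵢ ℝ ℂ).map_sub
  rw [← Lp.norm_fourier_eq (_ - _), ← Lp.norm_fourier_eq (f - g), e, e]
  refine Lp.norm_le_norm_of_ae_le ?_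
  filter_upwards [Lp.coeFn_sub (𝓕 (cosOp m τ f)) (𝓕 (cosOp m τ g)), Lp.coeFn_sub (𝓕 f) (𝓕 g),
    fourier_fourierMul (hm f), fourier_fourierMul (hm g)] with ξ h1 h2 h3 h4
  rw [h1, h2, Pi.sub_apply, Pi.sub_apply, cosOp, h3, h4, ← mul_sub, norm_mul, Complex.norm_real]
  exact mul_le_of_le_one_left (norm_nonneg _) (Real.abs_cos_le_one _)

theorem continuous_cosOp_apply (m : ℝ) (f : L2C) : Continuous fun τ => cosOp m τ f := by
  have hs := symb_continuous m
  have hm : ∀ τ, MemLp (fun ξ => (Real.cos (symb m ξ * τ) : ℂ) * (𝓕 f : L2C) ξ) 2 volume :=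
    fun τ => memLp_mul_fourier_of_le_one (by fun_prop) f fun ξ => Real.abs_cos_le_one _
  have e : ∀ f g : L2C, 𝓕 (f - g) = 𝓕 f - 𝓕 g := (Lp.fourierTransformₗᵢ ℝ ℂ).map_sub
  refine continuous_iff_continuousAt.2 fun τ₀ => ?_
  rw [ContinuousAt, ← tendsto_sub_nhds_zero_iff]
  have : Tendsto (fun τ => 𝓕 (cosOp m τ f - cosOp m τ₀ f)) (𝓝 τ₀) (𝓝 0) := by
    refine tendsto_zero_of_dominated (B := fun ξ => 2 * ‖(𝓕 f : L2C) ξ‖)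
      (G := fun τ ξ => ((Real.cos (symb m ξ * τ) - Real.cos (symb m ξ * τ₀) : ℝ) : ℂ) * (𝓕 f : L2C) ξ)
      (fun τ => ?_)
      ((Lp.memLp (𝓕 f : L2C)).norm.const_mul _) (.of_forall fun τ => .of_forall fun ξ => ?_)
      (.of_forall fun ξ => ?_)
    · rw [e]
      filter_upwards [Lp.coeFn_sub (𝓕 (cosOp m τ f)) (𝓕 (cosOp m τ₀ f)),
        fourier_fourierMul (hm τ), fourier_fourierMul (hm τ₀)] with ξ h1 h3 h4
      rw [h1, Pi.sub_apply, cosOp, cosOp, h3, h4, ← sub_mul]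
      push_cast; rfl
    · rw [norm_mul, Complex.norm_real, Real.norm_eq_abs]
      gcongr
      exact (abs_sub _ _).trans (by
        linarith [Real.abs_cos_le_one (symb m ξ * τ), Real.abs_cos_le_one (symb m ξ * τ₀)])
    · have : Continuous fun τ =>
          ((Real.cos (symb m ξ * τ) - Real.cos (symb m ξ * τ₀) : ℝ) : ℂ) * (𝓕 f : L2C) ξ := by fun_prop
      simpa using this.tendsto τ₀
  rw [tendsto_zero_iff_norm_tendsto_zero] at this ⊢
  simpa only [Lp.norm_fourier_eq] using this

theorem continuous_cosOp (m : ℝ) : Continuous fun p : ℝ × L2C => cosOp m p.1 p.2 := by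
  refine continuous_iff_continuousAt.2 fun ⟨τ₀, f₀⟩ => ?_
  rw [ContinuousAt, tendsto_iff_norm_sub_tendsto_zero]
  have h1 : Tendsto (fun p : ℝ × L2C => ‖p.2 - f₀‖ + ‖cosOp m p.1 f₀ - cosOp m τ₀ f₀‖)
      (𝓝 (τ₀, f₀)) (𝓝 0) := by
    have := continuous_cosOp_apply m f₀
    have : Continuous fun p : ℝ × L2C => ‖p.2 - f₀‖ + ‖cosOp m p.1 f₀ - cosOp m τ₀ f₀‖ := by fun_prop
    simpa using this.tendsto (τ₀, f₀)
  refine squeeze_zero (fun _ => norm_nonneg _) (fun p => ?_) h1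
  refine (norm_sub_le_norm_sub_add_norm_sub _ (cosOp m p.1 f₀) _).trans ?_
  gcongr
  exact norm_cosOp_sub_le _ _ _ _

theorem cosOp_zero (m : ℝ) (f : L2C) : cosOp m 0 f = f := by
  have h : MemLp (fun ξ => (Real.cos (symb m ξ * 0) : ℂ) * (𝓕 f : L2C) ξ) 2 volume := by
    simpa using Lp.memLp (𝓕 f : L2C)
  have := fourier_fourierMul (a := fun ξ => Real.cos (symb m ξ * 0)) h
  simp only [mul_zero, Real.cos_zero, Complex.ofReal_one, one_mul] at this
  apply (Lp.fourierTransformₗᵢ ℝ ℂ).injective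
  refine Lp.ext ?_
  simp only [cosOp, mul_zero, Real.cos_zero]
  exact this

theorem HasWeakDeriv.hasDerivAt_cosOp {f g : L2C} (h : HasWeakDeriv f g) (m : ℝ) :
    HasDerivAt (fun τ => cosOp m τ f) 0 0 := by
  have hs := symb_continuous m
  refine hasDerivAt_fourierMul (a := fun τ ξ => Real.cos (symb m ξ * τ)) (a' := fun _ => 0)
    (B := symb m) (fun τ => memLp_mul_fourier_of_le_one (by fun_prop) f fun ξ => Real.abs_cos_le_one _)
    (h.memLp_symb_mul m) (fun τ ξ => ?_) (fun ξ => ?_) ?_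
  · have := Real.abs_cos_sub_cos_le (symb m ξ * τ) 0
    simpa [abs_mul, abs_of_nonneg (symb_nonneg m ξ), mul_comm] using this
  · have := ((hasDerivAt_id (0:ℝ)).const_mul (symb m ξ)).cos
    simpa using this
  · have e : (𝓕 (0 : L2C)) = 0 := (Lp.fourierTransformₗᵢ ℝ ℂ).map_zero
    rw [e]
    simp only [Complex.ofReal_zero, zero_mul]
    exact Lp.coeFn_zero ℂ 2 volume

theorem HasWeakDeriv.hasDerivAt_mulSinOp {f g k : L2C} (h : HasWeakDeriv f g)
    (h' : HasWeakDeriv g k) (m : ℝ) :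
    HasDerivAt (fun τ => mulSinOp m τ f) ((m ^ 2 : ℂ) • f - k) 0 := by
  have hs := symb_continuous m
  have hsq : MemLp (fun ξ => symb m ξ ^ 2 * ‖(𝓕 f : L2C) ξ‖) 2 volume := by
    refine (Lp.memLp (𝓕 ((m ^ 2 : ℂ) • f - k) : L2C)).norm.ae_eq ?_
    filter_upwards [fourier_sq_smul_sub h h' m] with ξ hξ
    rw [hξ, norm_mul, Complex.norm_real, Real.norm_of_nonneg (sq_nonneg _)]
  refine hasDerivAt_fourierMul (a := fun τ ξ => symb m ξ * Real.sin (symb m ξ * τ))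
    (a' := fun ξ => symb m ξ ^ 2) (B := fun ξ => 2 * symb m ξ ^ 2)
    (fun τ => memLp_mul_fourier (by fun_prop) (h.memLp_symb_mul m) fun ξ => ?_)
    (by simpa only [mul_assoc] using hsq.const_mul 2) (fun τ ξ => ?_) (fun ξ => ?_)
    (fourier_sq_smul_sub h h' m)
  · rw [abs_mul, abs_of_nonneg (symb_nonneg m ξ)]
    exact mul_le_of_le_one_right (symb_nonneg m ξ) (Real.abs_sin_le_one _)
  · simp only [mul_zero, Real.sin_zero, sub_zero]
    have h1 := Real.abs_sin_le_abs (x := symb m ξ * τ)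
    have h0 := symb_nonneg m ξ
    rw [abs_mul, abs_of_nonneg h0] at h1
    calc _ ≤ |symb m ξ * Real.sin (symb m ξ * τ)| + |τ * symb m ξ ^ 2| := abs_sub _ _
      _ = symb m ξ * |Real.sin (symb m ξ * τ)| + |τ| * symb m ξ ^ 2 := by
        rw [abs_mul, abs_mul, abs_of_nonneg h0, abs_of_nonneg (sq_nonneg (symb m ξ))]
      _ ≤ symb m ξ * (symb m ξ * |τ|) + |τ| * symb m ξ ^ 2 := by gcongr
      _ = _ := by ring
  · have := (((hasDerivAt_id (0:ℝ)).const_mul (symb m ξ)).sin).const_mul (symb m ξ)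
    simpa [pow_two] using this

/-- The Duhamel integral has the derivative `f t₀` at its base point, where `cos(0⟨∂ₓ⟩) = 1`. -/
theorem hasDerivWithinAt_integral_cosOp {m T t₀ : ℝ} (ht₀ : T ≤ t₀) {f : ℝ → L2C}
    (hf : ContinuousOn f (Ici T)) :
    HasDerivWithinAt (fun t => ∫ s in t₀..t, cosOp m (t - s) (f s)) (f t₀) (Ici T) t₀ := by
  have hg : ContinuousOn (fun p : ℝ × ℝ => cosOp m (p.1 - p.2) (f p.2)) (Ici T ×ˢ Ici T) := by
    have h1 : ContinuousOn (fun p : ℝ × ℝ => f p.2) (Ici T ×ˢ Ici T) :=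
      hf.comp continuous_snd.continuousOn fun p hp => hp.2
    have h2 : ContinuousOn (fun p : ℝ × ℝ => (p.1 - p.2, f p.2)) (Ici T ×ˢ Ici T) :=
      (continuous_fst.sub continuous_snd).continuousOn.prodMk h1
    have h3 := (continuous_cosOp m).comp_continuousOn h2
    simp only [Function.comp_def] at h3
    exact h3
  rw [hasDerivWithinAt_iff_isLittleO, Asymptotics.isLittleO_iff]
  intro ε hε
  have h0 := hg (t₀, t₀) ⟨ht₀, ht₀⟩
  rw [Metric.continuousWithinAt_iff] at h0
  obtain ⟨δ, hδ, h0⟩ := h0 ε hε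
  filter_upwards [inter_mem_nhdsWithin (Ici T) (Metric.ball_mem_nhds t₀ hδ)] with t ht
  have hsub : uIcc t₀ t ⊆ Ici T := fun s hs => (le_min ht₀ ht.1).trans hs.1
  have hint : IntervalIntegrable (fun s => cosOp m (t - s) (f s)) volume t₀ t := by
    refine ContinuousOn.intervalIntegrable ?_
    have h1 : ContinuousOn (fun s : ℝ => (t, s)) (uIcc t₀ t) := by fun_prop
    have h2 := hg.comp h1 fun s hs => ⟨ht.1, hsub hs⟩
    simp only [Function.comp_def] at h2
    exact h2
  rw [intervalIntegral.integral_same, sub_zero, ← intervalIntegral.integral_const,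
    ← intervalIntegral.integral_sub hint intervalIntegrable_const, Real.norm_eq_abs]
  refine intervalIntegral.norm_integral_le_of_norm_le_const fun s hs => ?_
  have hs' := uIoc_subset_uIcc hs
  have hd : dist (t, s) (t₀, t₀) < δ := by
    rw [Prod.dist_eq, max_lt_iff]
    refine ⟨ht.2, ?_⟩
    have : |s - t₀| ≤ |t - t₀| := abs_sub_left_of_mem_uIcc hs'
    exact this.trans_lt ht.2
  have := h0 (show (t, s) ∈ Ici T ×ˢ Ici T from ⟨ht.1, hsub hs'⟩) hd
  simp only [sub_self, cosOp_zero] at this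
  rw [← dist_eq_norm]
  exact this.le

/-! ### Vector-valued functions and multiplication operators -/

theorem coeFn_comp (j : Fin N) (f : L2 N) :
    comp j f =ᵐ[volume] fun x => ((f x j : ℝ) : ℂ) :=
  ContinuousLinearMap.coeFn_compLpL _ f

/-- The embedding of the real part of a complex-valued function as the `j`-th
component of a vector-valued one whose other components vanish. -/
def single (j : Fin N) : L2C →L[ℝ] L2 N :=
  (((ContinuousLinearMap.toSpanSingleton ℝ (EuclideanSpace.single j 1 : Vec N)).comp
    Complex.reCLM)).compLpL 2 volume

theorem coeFn_single (j : Fin N) (f : L2C) :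
    single j f =ᵐ[volume] fun x => (f x).re • (EuclideanSpace.single j 1 : Vec N) :=
  ContinuousLinearMap.coeFn_compLpL _ f

theorem coeFn_sum {ι : Type*} (s : Finset ι) (f : ι → L2 N) :
    (∑ i ∈ s, f i : L2 N) =ᵐ[volume] fun x => ∑ i ∈ s, f i x := by
  classical
  induction s using Finset.induction_on with
  | empty => exact Lp.coeFn_zero (Vec N) 2 (volume : Measure ℝ)
  | insert a s ha ih =>
    rw [Finset.sum_insert ha]
    filter_upwards [Lp.coeFn_add (f a) (∑ i ∈ s, f i), ih] with x h1 h2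
    rw [h1, Pi.add_apply, h2, Finset.sum_insert ha]

theorem sum_single_comp (f : L2 N) : ∑ j, single j (comp j f) = f := by
  refine Lp.ext ?_
  have h1 : ∀ᵐ x, ∀ j, single j (comp j f) x = (comp j f x).re • (EuclideanSpace.single j 1 : Vec N) :=
    ae_all_iff.2 fun j => coeFn_single j _
  have h2 : ∀ᵐ x, ∀ j, comp j f x = ((f x j : ℝ) : ℂ) := ae_all_iff.2 fun j => coeFn_comp j f
  filter_upwards [coeFn_sum Finset.univ fun j => single j (comp j f), h1, h2] with x h h1 h2
  rw [h]
  simp only [h1, h2, Complex.ofReal_re]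
  ext i
  simp [Finset.sum_apply, Pi.single_apply]

theorem inner_eq_sum (f g : L2 N) :
    inner ℝ f g = ∑ j, (inner ℂ (comp j f) (comp j g)).re := by
  have h : ∀ j : Fin N, (inner ℂ (comp j f) (comp j g)).re = ∫ x, g x j * f x j := fun j => by
    rw [L2.inner_def]
    have : ∫ x, inner ℂ (comp j f x) (comp j g x) = ∫ x, ((g x j * f x j : ℝ) : ℂ) := by
      refine integral_congr_ae ?_
      filter_upwards [coeFn_comp j f, coeFn_comp j g] with x h1 h2
      rw [h1, h2]
      simp
    rw [this, integral_complex_ofReal, Complex.ofReal_re]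
  have hm : ∀ (j : Fin N) (f : L2 N), MemLp (fun x => f x j) 2 volume := fun j f =>
    (EuclideanSpace.proj j : Vec N →L[ℝ] ℝ).comp_memLp' (Lp.memLp f)
  simp only [h]
  rw [← integral_finsetSum, L2.inner_def]
  · simp [PiLp.inner_apply]
  · intro j _
    exact (hm j g).integrable_mul (hm j f)

theorem IsWeakDeriv.inner_eq {f f' g g' : L2 N} (hf : IsWeakDeriv f f') (hg : IsWeakDeriv g g') :
    inner ℝ f' g = - inner ℝ f g' := by
  rw [inner_eq_sum, inner_eq_sum, ← Finset.sum_neg_distrib]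
  refine Finset.sum_congr rfl fun j _ => ?_
  rw [HasWeakDeriv.inner_eq (hf j) (hg j), Complex.neg_re]

theorem norm_comp_le (j : Fin N) (f : L2 N) : ‖comp j f‖ ≤ ‖f‖ := by
  refine Lp.norm_le_norm_of_ae_le ?_
  filter_upwards [coeFn_comp j f] with x hx
  rw [hx, Complex.norm_real]
  exact PiLp.norm_apply_le (f x) j

theorem IsWeakDeriv.ae_norm_le {f g : L2 N} (h : IsWeakDeriv f g) :
    ∀ᵐ x, ‖f x‖ ≤ N * (2 + ‖f‖ ^ 2 + ‖g‖ ^ 2) := by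
  have h1 : ∀ᵐ x, ∀ j, ‖comp j f x‖ ≤ 2 + ‖comp j f‖ ^ 2 + ‖comp j g‖ ^ 2 :=
    ae_all_iff.2 fun j => HasWeakDeriv.ae_norm_le (h j)
  have h2 : ∀ᵐ x, ∀ j, comp j f x = ((f x j : ℝ) : ℂ) := ae_all_iff.2 fun j => coeFn_comp j f
  filter_upwards [h1, h2] with x h1 h2
  have h3 : ∀ j, ‖f x j‖ ≤ 2 + ‖f‖ ^ 2 + ‖g‖ ^ 2 := fun j => by
    have := h1 j
    rw [h2, Complex.norm_real] at this
    refine this.trans ?_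
    gcongr <;> exact norm_comp_le _ _
  have h4 : f x = ∑ j, (f x j) • (EuclideanSpace.single j 1 : Vec N) := by
    ext i; simp [Finset.sum_apply, Pi.single_apply]
  rw [h4]
  refine (norm_sum_le _ _).trans ?_
  refine (Finset.sum_le_card_nsmul _ _ (2 + ‖f‖ ^ 2 + ‖g‖ ^ 2) fun j _ => ?_).trans_eq
    (by rw [Finset.card_univ, Fintype.card_fin, nsmul_eq_mul])
  rw [norm_smul]
  simpa using h3 j

theorem memLp_bcf_smul (a : ℝ →ᵇ ℝ) (f : L2 N) : MemLp (fun x => a x • f x) 2 volume :=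
  (Lp.memLp f).of_le_mul (c := ‖a‖) (a.continuous.aestronglyMeasurable.smul (Lp.aestronglyMeasurable f))
    (.of_forall fun x => by rw [norm_smul]; gcongr; exact a.norm_coe_le_norm x)

/-- Multiplication by bounded continuous functions, as a bounded bilinear map on `L²`. -/
def mulOp : (ℝ →ᵇ ℝ) →L[ℝ] L2 N →L[ℝ] L2 N :=
  LinearMap.mkContinuous₂
    (LinearMap.mk₂ ℝ (fun (a : ℝ →ᵇ ℝ) (f : L2 N) => ((memLp_bcf_smul a f).toLp : L2 N))
      (fun a b f => by
        rw [← MemLp.toLp_add]; congr 1; ext1 x; simp [add_smul])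
      (fun c a f => by
        rw [← MemLp.toLp_const_smul]; congr 1; ext1 x; simp [mul_smul])
      (fun a f g => by
        rw [← MemLp.toLp_add]
        refine MemLp.toLp_congr _ _ ?_
        filter_upwards [Lp.coeFn_add f g] with x hx
        rw [Pi.add_apply, hx, Pi.add_apply, smul_add])
      (fun c a f => by
        rw [← MemLp.toLp_const_smul]
        refine MemLp.toLp_congr _ _ ?_
        filter_upwards [Lp.coeFn_smul c f] with x hx
        rw [Pi.smul_apply, hx, Pi.smul_apply, smul_comm]))
    1 (fun a f => by
      rw [one_mul]
      refine Lp.norm_le_mul_norm_of_ae_le_mul ?_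
      filter_upwards [(memLp_bcf_smul a f).coeFn_toLp] with x hx
      simp only [LinearMap.mk₂_apply]
      rw [hx, norm_smul]
      gcongr; exact a.norm_coe_le_norm x)

theorem coeFn_mulOp (a : ℝ →ᵇ ℝ) (f : L2 N) : mulOp a f =ᵐ[volume] fun x => a x • f x :=
  (memLp_bcf_smul a f).coeFn_toLp

theorem inner_mulOp (a : ℝ →ᵇ ℝ) (f g : L2 N) :
    inner ℝ (mulOp a f) g = ∫ x, a x * inner ℝ (f x) (g x) := by
  rw [L2.inner_def]
  refine integral_congr_ae ?_
  filter_upwards [coeFn_mulOp a f] with x hx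
  rw [hx, real_inner_smul_left]

theorem integrable_inner_mul (a : ℝ →ᵇ ℝ) (f g : L2 N) :
    Integrable fun x => a x * inner ℝ (f x) (g x) := by
  refine (L2.integrable_inner (𝕜 := ℝ) (mulOp a f) g).congr ?_
  filter_upwards [coeFn_mulOp a f] with x hx
  rw [hx, real_inner_smul_left]

theorem inner_mulOp_comm (a : ℝ →ᵇ ℝ) (f g : L2 N) :
    inner ℝ (mulOp a f) g = inner ℝ (mulOp a g) f := by
  rw [inner_mulOp, inner_mulOp]
  simp only [real_inner_comm]

theorem HasWeakDeriv.mul {f g F G : L2C} (h : HasWeakDeriv f g) {a b : ℝ →ᵇ ℝ}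
    (ha : Function.HasTemperateGrowth (a : ℝ → ℝ)) (hab : ∀ x, HasDerivAt a (b x) x)
    (hF : F =ᵐ[volume] fun x => (a x : ℂ) * f x)
    (hG : G =ᵐ[volume] fun x => (b x : ℂ) * f x + a x * g x) : HasWeakDeriv F G := by
  rw [hasWeakDeriv_iff]
  intro φ
  have ha' : Function.HasTemperateGrowth fun x => (a x : ℂ) := by fun_prop
  have h1 := h.integral_eq (SchwartzMap.smulLeftCLM ℂ (fun x => (a x : ℂ)) φ)
  have hd : ∀ x, deriv (SchwartzMap.smulLeftCLM ℂ (fun x => (a x : ℂ)) φ) x =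
      (b x : ℂ) * φ x + a x * deriv φ x := fun x => by
    rw [SchwartzMap.smulLeftCLM_apply ha']
    simp only [smul_eq_mul]
    exact ((hab x).ofReal_comp.mul (φ.hasDerivAt x)).deriv
  simp only [hd, SchwartzMap.smulLeftCLM_apply_apply ha', smul_eq_mul] at h1
  have hφ : MemLp φ 2 (volume : Measure ℝ) := φ.memLp 2
  have hφ' : MemLp (deriv φ) 2 (volume : Measure ℝ) :=
    (SchwartzMap.derivCLM ℂ ℂ φ).memLp 2 volume
  have hmul : ∀ (c : ℝ →ᵇ ℝ) {ψ : ℝ → ℂ} (_ : MemLp ψ 2 volume) (k : L2C),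
      Integrable fun x => (c x : ℂ) * (ψ x * k x) := fun c ψ hψ k => by
    refine (hψ.integrable_mul (Lp.memLp k)).bdd_mul (c := ‖c‖) ?_ ?_
    · exact (Complex.continuous_ofReal.comp c.continuous).aestronglyMeasurable
    · exact .of_forall fun x => by rw [Complex.norm_real]; exact c.norm_coe_le_norm x
  have e1 : ∫ x, ((b x : ℂ) * φ x + a x * deriv φ x) * f x =
      (∫ x, (b x : ℂ) * (φ x * f x)) + ∫ x, (a x : ℂ) * (deriv φ x * f x) := by
    rw [← integral_add (hmul b hφ f) (hmul a hφ' f)]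
    congr 1; ext x; ring
  have e2 : ∫ x, deriv φ x * F x = ∫ x, (a x : ℂ) * (deriv φ x * f x) :=
    integral_congr_ae (hF.mono fun x hx => by simp only [hx]; ring)
  have e3 : ∫ x, φ x * G x = (∫ x, (b x : ℂ) * (φ x * f x)) + ∫ x, (a x : ℂ) * φ x * g x := by
    have := hmul a hφ g
    simp only [← mul_assoc] at this
    rw [← integral_add (hmul b hφ f) this]
    exact integral_congr_ae (hG.mono fun x hx => by simp only [hx]; ring)
  rw [e2, e3]
  rw [e1] at h1
  linear_combination h1

/-- The product rule for a weight of temperate growth. -/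
theorem IsWeakDeriv.mul {f g : L2 N} (h : IsWeakDeriv f g) {a b : ℝ →ᵇ ℝ}
    (ha : Function.HasTemperateGrowth (a : ℝ → ℝ)) (hab : ∀ x, HasDerivAt a (b x) x) :
    IsWeakDeriv (mulOp a f) (mulOp b f + mulOp a g) := by
  intro j
  refine HasWeakDeriv.mul (f := comp j f) (g := comp j g) (h j) ha hab ?_ ?_
  · filter_upwards [coeFn_comp j (mulOp a f), coeFn_comp j f, coeFn_mulOp a f] with x h1 h2 h3
    rw [h1, h2, h3]; simp
  · filter_upwards [coeFn_comp j (mulOp b f + mulOp a g), coeFn_comp j f, coeFn_comp j g,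
      coeFn_mulOp a g, coeFn_mulOp b f, Lp.coeFn_add (mulOp b f) (mulOp a g)]
      with x h1 h2 h3 h4 h5 h6
    rw [h1, h2, h3, h6, Pi.add_apply, h5, h4]; simp

/-- Weighted integration by parts, `∫ a (f·g' + g·f') = -∫ a' f·g`. -/
theorem IsWeakDeriv.inner_mulOp_add {f f' g g' : L2 N} (hf : IsWeakDeriv f f')
    (hg : IsWeakDeriv g g') {a b : ℝ →ᵇ ℝ}
    (ha : Function.HasTemperateGrowth (a : ℝ → ℝ)) (hab : ∀ x, HasDerivAt a (b x) x) :
    inner ℝ (mulOp a f) g' + inner ℝ (mulOp a g) f' =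
      - inner ℝ (mulOp b f) g := by
  have h := (hf.mul ha hab).inner_eq hg
  rw [inner_add_left] at h
  rw [inner_mulOp_comm a g f']
  linarith

/-! ### The equation in `L²` -/

/-- `der i` as a continuous linear map. -/
def derL {k : ℕ} (i : Fin (k + 1)) : Sobolev N k →L[ℝ] L2 N :=
  (PiLp.proj 2 (fun _ : Fin (k + 1) => L2 N) i).comp (Sobolev N k).subtypeL

theorem isWeakDeriv_der {k : ℕ} (f : Sobolev N k) (i : Fin k) :
    IsWeakDeriv (der i.castSucc f) (der i.succ f) := f.2 i

theorem IsWeakDeriv.eq_zero {g : L2 N} (h : IsWeakDeriv 0 g) : g = 0 := by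
  have h0 : ∀ j : Fin N, comp j g = 0 := fun j => by
    have hj := h j
    simp only [map_zero, ← Lp.toTemperedDistributionCLM_apply] at hj
    have hk := LinearMap.ker_eq_bot'.1
      (Lp.ker_toTemperedDistributionCLM_eq_bot (F := ℂ) (μ := (volume : Measure ℝ)) (p := 2))
    exact hk _ hj.symm
  rw [← sum_single_comp g]
  simp [h0]

section Forcing

variable {F : Vec N × Vec N × Vec N → Vec N}

theorem memLp_nemytskii {K : ℝ≥0} {M : ℝ} (hc : Continuous F) (h0 : F 0 = 0)
    (hK : LipschitzOnWith K F (Metric.closedBall 0 M)) (hM : 0 ≤ M)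
    {ζ η θ : L2 N} (hζ : ∀ᵐ x, ‖ζ x‖ ≤ M) (hη : ∀ᵐ x, ‖η x‖ ≤ M) (hθ : ∀ᵐ x, ‖θ x‖ ≤ M) :
    MemLp (fun x => F (ζ x, η x, θ x)) 2 volume := by
  have h1 : MemLp (fun x => ‖ζ x‖ + ‖η x‖ + ‖θ x‖) 2 volume :=
    ((Lp.memLp ζ).norm.add (Lp.memLp η).norm).add (Lp.memLp θ).norm
  refine h1.of_le_mul (c := K) (hc.comp_aestronglyMeasurable ((Lp.aestronglyMeasurable ζ).prodMk
    ((Lp.aestronglyMeasurable η).prodMk (Lp.aestronglyMeasurable θ)))) ?_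
  filter_upwards [hζ, hη, hθ] with x a b c
  have := hK.norm_sub_le (x := (ζ x, η x, θ x)) (y := 0)
    (by simp [Prod.norm_def, a, b, c]) (by simpa using hM)
  rw [h0, sub_zero, sub_zero] at this
  refine this.trans ?_
  gcongr
  refine le_trans ?_ (le_abs_self _)
  simp only [Prod.norm_def]
  refine max_le ?_ (max_le ?_ ?_) <;> linarith [norm_nonneg (ζ x), norm_nonneg (η x), norm_nonneg (θ x)]

theorem norm_nemytskii_sub_le {K : ℝ≥0} {M : ℝ} (hc : Continuous F) (h0 : F 0 = 0)
    (hK : LipschitzOnWith K F (Metric.closedBall 0 M)) (hM : 0 ≤ M)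
    {ζ η θ ζ' η' θ' : L2 N} (hζ : ∀ᵐ x, ‖ζ x‖ ≤ M) (hη : ∀ᵐ x, ‖η x‖ ≤ M) (hθ : ∀ᵐ x, ‖θ x‖ ≤ M)
    (hζ' : ∀ᵐ x, ‖ζ' x‖ ≤ M) (hη' : ∀ᵐ x, ‖η' x‖ ≤ M) (hθ' : ∀ᵐ x, ‖θ' x‖ ≤ M) :
    ‖nemytskii F ζ η θ - nemytskii F ζ' η' θ'‖ ≤
      K * (‖ζ - ζ'‖ + ‖η - η'‖ + ‖θ - θ'‖) := by
  have m1 := memLp_nemytskii hc h0 hK hM hζ hη hθ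
  have m2 := memLp_nemytskii hc h0 hK hM hζ' hη' hθ'
  rw [nemytskii, nemytskii, dif_pos m1, dif_pos m2]
  have h1 : MemLp (fun x => ‖(ζ - ζ') x‖ + ‖(η - η') x‖ + ‖(θ - θ') x‖) 2 volume :=
    ((Lp.memLp _).norm.add (Lp.memLp _).norm).add (Lp.memLp _).norm
  have h2 : ‖m1.toLp - m2.toLp‖ ≤ K * ‖h1.toLp‖ := by
    refine Lp.norm_le_mul_norm_of_ae_le_mul ?_
    filter_upwards [hζ, hη, hθ, hζ', hη', hθ', Lp.coeFn_sub m1.toLp m2.toLp, m1.coeFn_toLp,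
      m2.coeFn_toLp, h1.coeFn_toLp, Lp.coeFn_sub ζ ζ', Lp.coeFn_sub η η', Lp.coeFn_sub θ θ']
      with x a b c a' b' c' e1 e2 e3 e4 e5 e6 e7
    rw [e1, Pi.sub_apply, e2, e3, e4, e5, e6, e7, Pi.sub_apply, Pi.sub_apply, Pi.sub_apply]
    refine (hK.norm_sub_le (x := (ζ x, η x, θ x)) (y := (ζ' x, η' x, θ' x))
      (by simp [Prod.norm_def, a, b, c]) (by simp [Prod.norm_def, a', b', c'])).trans ?_
    gcongr
    refine le_trans ?_ (le_abs_self _)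
    simp only [Prod.norm_def, Prod.fst_sub, Prod.snd_sub]
    refine max_le ?_ (max_le ?_ ?_) <;>
      linarith [norm_nonneg (ζ x - ζ' x), norm_nonneg (η x - η' x), norm_nonneg (θ x - θ' x)]
  refine h2.trans ?_
  gcongr
  have e : ∀ f : L2 N, ‖(Lp.memLp f).norm.toLp‖ = ‖f‖ := fun f => by
    rw [Lp.norm_toLp, eLpNorm_norm, Lp.norm_def]
  have h3 : h1.toLp = (Lp.memLp (ζ - ζ')).norm.toLp + (Lp.memLp (η - η')).norm.toLp
      + (Lp.memLp (θ - θ')).norm.toLp := rfl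
  rw [h3, ← e (ζ - ζ'), ← e (η - η'), ← e (θ - θ')]
  exact norm_add₃_le

theorem exists_lipschitzOnWith_closedBall (hF : ContDiff ℝ 1 F) (M : ℝ) :
    ∃ K, LipschitzOnWith K F (Metric.closedBall 0 M) :=
  hF.locallyLipschitz.locallyLipschitzOn.exists_lipschitzOnWith_of_compact (isCompact_closedBall 0 M)

end Forcing

section Solution

variable {F : Vec N × Vec N × Vec N → Vec N} {m T : ℝ} {u : ℝ → Sobolev N 2}

theorem IsSolution.hasDerivWithinAt_incl (hu : IsSolution F m (Ici T) u) {t : ℝ} (ht : T ≤ t) :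
    HasDerivWithinAt (fun s => incl (u s)) (timeDeriv (Ici T) u t) (Ici T) t :=
  (hu.contDiffOn.differentiableOn (by norm_num) t ht).hasDerivWithinAt

theorem IsSolution.hasDerivWithinAt_der_zero (hu : IsSolution F m (Ici T) u) {t : ℝ} (ht : T ≤ t) :
    HasDerivWithinAt (fun s => der 0 (u s)) (der 0 (timeDeriv (Ici T) u t)) (Ici T) t :=
  (derL (N := N) (k := 1) 0).hasFDerivAt.comp_hasDerivWithinAt t (hu.hasDerivWithinAt_incl ht)

theorem IsSolution.hasDerivWithinAt_der_one (hu : IsSolution F m (Ici T) u) {t : ℝ} (ht : T ≤ t) :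
    HasDerivWithinAt (fun s => der 1 (u s)) (der 1 (timeDeriv (Ici T) u t)) (Ici T) t :=
  (derL (N := N) (k := 1) 1).hasFDerivAt.comp_hasDerivWithinAt t (hu.hasDerivWithinAt_incl ht)

theorem IsSolution.continuousOn_timeDeriv (hu : IsSolution F m (Ici T) u) :
    ContinuousOn (timeDeriv (Ici T) u) (Ici T) :=
  hu.contDiffOn.continuousOn_derivWithin (uniqueDiffOn_Ici T) le_rfl

/-- On bounded time intervals `u`, `∂ₓ u` and `∂ₜ u` are bounded, by the Sobolev embedding. -/
theorem IsSolution.exists_ae_norm_le (hu : IsSolution F m (Ici T) u) (b : ℝ) :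
    ∃ M, 0 ≤ M ∧ ∀ t ∈ Icc T b, (∀ᵐ x, ‖der 0 (u t) x‖ ≤ M) ∧ (∀ᵐ x, ‖der 1 (u t) x‖ ≤ M) ∧
      ∀ᵐ x, ‖der 0 (timeDeriv (Ici T) u t) x‖ ≤ M := by
  have hsub : Icc T b ⊆ Ici T := Icc_subset_Ici_self
  have c1 : ∀ i, ContinuousOn (fun t => der i (u t)) (Icc T b) := fun i =>
    (derL i).continuous.comp_continuousOn (hu.continuousOn.mono hsub)
  have c2 : ∀ i, ContinuousOn (fun t => der i (timeDeriv (Ici T) u t)) (Icc T b) := fun i =>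
    (derL i).continuous.comp_continuousOn (hu.continuousOn_timeDeriv.mono hsub)
  have c : ContinuousOn (fun t => (N : ℝ) * (2 + ‖der 0 (u t)‖ ^ 2 + ‖der 1 (u t)‖ ^ 2) +
      N * (2 + ‖der 1 (u t)‖ ^ 2 + ‖der 2 (u t)‖ ^ 2) +
      N * (2 + ‖der 0 (timeDeriv (Ici T) u t)‖ ^ 2 + ‖der 1 (timeDeriv (Ici T) u t)‖ ^ 2)) (Icc T b) := by
    have := c1 0
    have := c1 1
    have := c1 2
    have := c2 0
    have := c2 1
    fun_prop
  obtain ⟨M, hM⟩ := isCompact_Icc.bddAbove_image c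
  refine ⟨max M 0, le_max_right _ _, fun t ht => ?_⟩
  have hMt := (hM (mem_image_of_mem _ ht)).trans (le_max_left M 0)
  have p1 : 0 ≤ (N : ℝ) * (2 + ‖der 0 (u t)‖ ^ 2 + ‖der 1 (u t)‖ ^ 2) := by positivity
  have p2 : 0 ≤ (N : ℝ) * (2 + ‖der 1 (u t)‖ ^ 2 + ‖der 2 (u t)‖ ^ 2) := by positivity
  have p3 : 0 ≤ (N : ℝ) * (2 + ‖der 0 (timeDeriv (Ici T) u t)‖ ^ 2 + ‖der 1 (timeDeriv (Ici T) u t)‖ ^ 2) := by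
    positivity
  refine ⟨((isWeakDeriv_der (u t) 0).ae_norm_le).mono fun x hx => hx.trans ?_,
    ((isWeakDeriv_der (u t) 1).ae_norm_le).mono fun x hx => hx.trans ?_,
    ((isWeakDeriv_der (timeDeriv (Ici T) u t) 0).ae_norm_le).mono fun x hx => hx.trans ?_⟩
  · exact le_trans (by change (N : ℝ) * (2 + ‖der 0 (u t)‖ ^ 2 + ‖der 1 (u t)‖ ^ 2) ≤ _; linarith) hMt
  · exact le_trans (by change (N : ℝ) * (2 + ‖der 1 (u t)‖ ^ 2 + ‖der 2 (u t)‖ ^ 2) ≤ _; linarith) hMt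
  · exact le_trans (by
      change (N : ℝ) * (2 + ‖der 0 (timeDeriv (Ici T) u t)‖ ^ 2
        + ‖der 1 (timeDeriv (Ici T) u t)‖ ^ 2) ≤ _
      linarith) hMt

theorem IsSolution.continuousOn_forcing (hu : IsSolution F m (Ici T) u) (hF : ContDiff ℝ 1 F)
    (h0 : F 0 = 0) : ContinuousOn (forcing F (Ici T) u) (Ici T) := by
  intro t₀ ht₀
  obtain ⟨M, hM, hb⟩ := hu.exists_ae_norm_le (t₀ + 1)
  obtain ⟨K, hK⟩ := exists_lipschitzOnWith_closedBall hF M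
  rw [ContinuousWithinAt, tendsto_iff_norm_sub_tendsto_zero]
  have c1 : ∀ i, ContinuousWithinAt (fun t => der i (u t)) (Ici T) t₀ := fun i =>
    ((derL i).continuous.comp_continuousOn hu.continuousOn) t₀ ht₀
  have c2 : ∀ i, ContinuousWithinAt (fun t => der i (timeDeriv (Ici T) u t)) (Ici T) t₀ := fun i =>
    ((derL i).continuous.comp_continuousOn hu.continuousOn_timeDeriv) t₀ ht₀
  have h1 : Tendsto (fun t => (K : ℝ) * (‖der 0 (u t) - der 0 (u t₀)‖ +
      ‖der 0 (timeDeriv (Ici T) u t) - der 0 (timeDeriv (Ici T) u t₀)‖ +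
      ‖der 1 (u t) - der 1 (u t₀)‖)) (𝓝[Ici T] t₀) (𝓝 0) := by
    have a := tendsto_iff_norm_sub_tendsto_zero.1 (c1 0)
    have b := tendsto_iff_norm_sub_tendsto_zero.1 (c2 0)
    have c := tendsto_iff_norm_sub_tendsto_zero.1 (c1 1)
    simpa using ((a.add b).add c).const_mul (K : ℝ)
  refine squeeze_zero' (.of_forall fun _ => norm_nonneg _) ?_ h1
  filter_upwards [inter_mem_nhdsWithin (Ici T) (Iic_mem_nhds (lt_add_one t₀))] with t ht
  obtain ⟨a1, a2, a3⟩ := hb t ht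
  obtain ⟨b1, b2, b3⟩ := hb t₀ ⟨ht₀, (lt_add_one t₀).le⟩
  exact norm_nemytskii_sub_le hF.continuous h0 hK hM a1 a3 a2 b1 b3 b2

/-- The equation holds in `L²`: `∂ₜ² u = ∂ₓ² u - m² u + F`. The second Duhamel row is differentiated
at its base point `t₀`, which may be any time. -/
theorem IsSolution.hasDerivWithinAt_timeDeriv (hu : IsSolution F m (Ici T) u) (hF : ContDiff ℝ 1 F)
    (h0 : F 0 = 0) {t₀ : ℝ} (ht₀ : T ≤ t₀) :
    HasDerivWithinAt (fun s => der 0 (timeDeriv (Ici T) u s))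
      (der 2 (u t₀) - m ^ 2 • der 0 (u t₀) + forcing F (Ici T) u t₀) (Ici T) t₀ := by
  have hj : ∀ j : Fin N, HasDerivWithinAt (fun s => comp j (der 0 (timeDeriv (Ici T) u s)))
      (comp j (der 2 (u t₀) - m ^ 2 • der 0 (u t₀) + forcing F (Ici T) u t₀)) (Ici T) t₀ := by
    intro j
    have w0 : HasWeakDeriv (comp j (der 0 (u t₀))) (comp j (der 1 (u t₀))) :=
      isWeakDeriv_der (u t₀) 0 j
    have w1 : HasWeakDeriv (comp j (der 1 (u t₀))) (comp j (der 2 (u t₀))) :=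
      isWeakDeriv_der (u t₀) 1 j
    have w2 : HasWeakDeriv (comp j (der 0 (timeDeriv (Ici T) u t₀)))
        (comp j (der 1 (timeDeriv (Ici T) u t₀))) := isWeakDeriv_der (timeDeriv (Ici T) u t₀) 0 j
    have hsub : HasDerivAt (fun t => t - t₀) 1 t₀ := (hasDerivAt_id t₀).sub_const t₀
    have d1 : HasDerivAt (fun t => mulSinOp m (t - t₀) (comp j (der 0 (u t₀))))
        ((m ^ 2 : ℂ) • comp j (der 0 (u t₀)) - comp j (der 2 (u t₀))) t₀ := by
      have := HasDerivAt.scomp t₀ (h := fun t => t - t₀) (by simpa using w0.hasDerivAt_mulSinOp w1 m) hsub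
      simpa [Function.comp_def] using this
    have d2 : HasDerivAt (fun t => cosOp m (t - t₀) (comp j (der 0 (timeDeriv (Ici T) u t₀)))) 0 t₀ := by
      have := HasDerivAt.scomp t₀ (h := fun t => t - t₀) (by simpa using w2.hasDerivAt_cosOp m) hsub
      simpa [Function.comp_def] using this
    have d3 := hasDerivWithinAt_integral_cosOp (m := m) ht₀
      ((comp j).continuous.comp_continuousOn (hu.continuousOn_forcing hF h0))
    have d := (d1.hasDerivWithinAt.neg.add d2.hasDerivWithinAt).add d3
    have e : -((m ^ 2 : ℂ) • comp j (der 0 (u t₀)) - comp j (der 2 (u t₀))) + 0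
        + comp j (forcing F (Ici T) u t₀) =
        comp j (der 2 (u t₀) - m ^ 2 • der 0 (u t₀) + forcing F (Ici T) u t₀) := by
      rw [map_add, map_sub, comp_smul]
      push_cast
      abel
    rw [← e]
    exact d.congr_of_mem (fun t ht => hu.duhamel_deriv t₀ ht₀ t ht j) ht₀
  have := HasDerivWithinAt.fun_sum (u := Finset.univ) fun j _ =>
    (single (N := N) j).hasFDerivAt.comp_hasDerivWithinAt t₀ (hj j)
  simpa only [Function.comp_def, sum_single_comp] using this

end Solution

/-! ### The light-cone weight -/

/-- A smooth increasing transition from `0` to `1`, `s ↦ (1 + s / √(1 + s²)) / 2`. Powers of `1 + s²`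
have temperate growth, and `step s` decays like `s⁻²` as `s → -∞`. -/
def step (s : ℝ) : ℝ := 1 / 2 * (1 + s * (1 + s ^ 2) ^ (-1 / 2 : ℝ))

/-- The derivative of `step`. -/
def stepDeriv (s : ℝ) : ℝ := 1 / 2 * (1 + s ^ 2) ^ (-3 / 2 : ℝ)

theorem hasDerivAt_one_add_sq_rpow (r s : ℝ) :
    HasDerivAt (fun s : ℝ => (1 + s ^ 2) ^ r) (2 * r * s * (1 + s ^ 2) ^ (r - 1)) s := by
  have h := (((hasDerivAt_id s).pow 2).const_add 1).rpow_const (p := r)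
    (Or.inl (by simp only [Pi.pow_apply, id]; positivity))
  refine h.congr_deriv ?_
  simp only [Pi.pow_apply, id]
  push_cast
  ring

theorem hasDerivAt_step (s : ℝ) : HasDerivAt step (stepDeriv s) s := by
  have h := (((hasDerivAt_id s).mul (hasDerivAt_one_add_sq_rpow (-1 / 2) s)).const_add 1).const_mul (1 / 2)
  refine h.congr_deriv ?_
  have e : (1 + s ^ 2) ^ (-1 / 2 : ℝ) = (1 + s ^ 2) * (1 + s ^ 2) ^ (-3 / 2 : ℝ) := by
    rw [← Real.rpow_one_add' (by positivity) (by norm_num)]; norm_num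
  rw [stepDeriv, e, show (-1 / 2 - 1 : ℝ) = -3 / 2 by norm_num]
  simp only [id]
  ring

theorem hasDerivAt_stepDeriv (s : ℝ) :
    HasDerivAt stepDeriv (-(3 / 2) * s * (1 + s ^ 2) ^ (-5 / 2 : ℝ)) s := by
  have h := (hasDerivAt_one_add_sq_rpow (-3 / 2) s).const_mul (1 / 2)
  refine h.congr_deriv ?_
  rw [show (-3 / 2 - 1 : ℝ) = -5 / 2 by norm_num]
  ring

theorem abs_deriv_stepDeriv_le (s : ℝ) : |(-(3 / 2) * s * (1 + s ^ 2) ^ (-5 / 2 : ℝ))| ≤ 3 / 2 := by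
  have e : (1 + s ^ 2) ^ (-5 / 2 : ℝ) ≤ (1 + s ^ 2) ^ (-1 : ℝ) :=
    Real.rpow_le_rpow_of_exponent_le (by nlinarith [sq_nonneg s]) (by norm_num)
  have hp : 0 < (1 + s ^ 2) ^ (-5 / 2 : ℝ) := by positivity
  rw [Real.rpow_neg_one] at e
  have h1 : |s| ≤ 1 + s ^ 2 := by nlinarith [sq_nonneg (|s| - 1), sq_abs s]
  rw [abs_mul, abs_mul, abs_of_pos hp]
  have : |s| * (1 + s ^ 2) ^ (-5 / 2 : ℝ) ≤ 1 := by
    calc _ ≤ (1 + s ^ 2) * (1 + s ^ 2)⁻¹ := by gcongr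
      _ = 1 := mul_inv_cancel₀ (by positivity)
  have e2 : |(-(3 / 2) : ℝ)| = 3 / 2 := by rw [abs_neg]; norm_num
  rw [e2]
  linarith

theorem stepDeriv_pos (s : ℝ) : 0 < stepDeriv s := by unfold stepDeriv; positivity

theorem stepDeriv_le (s : ℝ) : stepDeriv s ≤ 1 := by
  have : (1 + s ^ 2) ^ (-3 / 2 : ℝ) ≤ 1 :=
    Real.rpow_le_one_of_one_le_of_nonpos (by nlinarith [sq_nonneg s]) (by norm_num)
  unfold stepDeriv; linarith

theorem abs_mul_rpow_lt_one (s : ℝ) : |s * (1 + s ^ 2) ^ (-1 / 2 : ℝ)| < 1 := by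
  rw [show (-1 / 2 : ℝ) = -(1 / 2) by norm_num, Real.rpow_neg (by positivity), ← Real.sqrt_eq_rpow,
    ← div_eq_mul_inv, abs_div, abs_of_pos (Real.sqrt_pos.2 (by positivity : 0 < 1 + s ^ 2)),
    div_lt_one (Real.sqrt_pos.2 (by positivity))]
  exact Real.lt_sqrt_of_sq_lt (by rw [sq_abs]; linarith)

theorem step_pos (s : ℝ) : 0 < step s := by
  have := (abs_lt.1 (abs_mul_rpow_lt_one s)).1
  unfold step; linarith

theorem step_le_one (s : ℝ) : step s ≤ 1 := by
  have := (abs_lt.1 (abs_mul_rpow_lt_one s)).2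
  unfold step; linarith

theorem step_le_of_nonpos {s : ℝ} (hs : s ≤ 0) : step s ≤ (1 + s ^ 2)⁻¹ := by
  have hr : 0 < √(1 + s ^ 2) := Real.sqrt_pos.2 (by positivity)
  have hr2 : √(1 + s ^ 2) ^ 2 = 1 + s ^ 2 := Real.sq_sqrt (by positivity)
  rw [step, show (-1 / 2 : ℝ) = -(1 / 2) by norm_num, Real.rpow_neg (by positivity),
    ← Real.sqrt_eq_rpow]
  rw [← hr2]
  set r := √(1 + s ^ 2)
  rw [Real.sqrt_sq hr.le]
  have hrs : 0 ≤ r + s := by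
    have : |s| ≤ r := Real.abs_le_sqrt (by linarith)
    linarith [(abs_le.1 this).1]
  have hle : r * (r + s) ≤ 1 := by nlinarith
  have e : 1 / 2 * (1 + s * r⁻¹) = (1 / 2 * (r * (r + s))) * (r ^ 2)⁻¹ := by field_simp
  rw [e]
  exact mul_le_of_le_one_left (by positivity) (by linarith)

theorem abs_step_sub_le (s h : ℝ) : |step (s + h) - step s - h * stepDeriv s| ≤ 3 / 2 * h ^ 2 := by
  have hl : ∀ a b, |stepDeriv b - stepDeriv a| ≤ 3 / 2 * |b - a| := fun a b =>
    Convex.norm_image_sub_le_of_norm_hasDerivWithin_le (s := univ)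
      (fun x _ => (hasDerivAt_stepDeriv x).hasDerivWithinAt)
      (fun x _ => abs_deriv_stepDeriv_le x) convex_univ (mem_univ a) (mem_univ b)
  have := Convex.norm_image_sub_le_of_norm_hasDerivWithin_le (s := uIcc s (s + h))
    (f := fun y => step y - y * stepDeriv s) (f' := fun y => stepDeriv y - 1 * stepDeriv s)
    (C := 3 / 2 * |h|) (x := s) (y := s + h)
      (fun x _ => ((hasDerivAt_step x).sub ((hasDerivAt_id x).mul_const _)).hasDerivWithinAt)
      (fun x hx => ?_) (convex_uIcc _ _) left_mem_uIcc right_mem_uIcc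
  · rw [add_sub_cancel_left, Real.norm_eq_abs, Real.norm_eq_abs, mul_assoc, abs_mul_abs_self] at this
    rw [pow_two]
    convert this using 2
    ring
  · rw [one_mul]
    refine (hl s x).trans ?_
    have := abs_sub_left_of_mem_uIcc hx
    rw [add_sub_cancel_left] at this
    exact mul_le_mul_of_nonneg_left this (by norm_num)

theorem step_hasTemperateGrowth : Function.HasTemperateGrowth step := by
  have h := Function.hasTemperateGrowth_one_add_norm_sq_rpow ℝ (-1 / 2)
  simp only [Real.norm_eq_abs, sq_abs] at h
  unfold step
  fun_prop

/-- The smooth substitute `√(1 + x²)` for `|x|`; its derivative has absolute value less than `1`. -/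
def jap (x : ℝ) : ℝ := (1 + x ^ 2) ^ (1 / 2 : ℝ)

theorem jap_hasTemperateGrowth : Function.HasTemperateGrowth jap := by
  have h := Function.hasTemperateGrowth_one_add_norm_sq_rpow ℝ (1 / 2)
  simp only [Real.norm_eq_abs, sq_abs] at h
  exact h

theorem hasDerivAt_jap (x : ℝ) : HasDerivAt jap (x * (1 + x ^ 2) ^ (-1 / 2 : ℝ)) x := by
  refine (hasDerivAt_one_add_sq_rpow (1 / 2) x).congr_deriv ?_
  rw [show (1 / 2 - 1 : ℝ) = -1 / 2 by norm_num]
  ring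

theorem abs_le_jap (x : ℝ) : |x| ≤ jap x := by
  rw [jap, ← Real.sqrt_eq_rpow]
  exact Real.abs_le_sqrt (by linarith)

theorem continuous_step : Continuous step :=
  continuous_iff_continuousAt.2 fun s => (hasDerivAt_step s).continuousAt

theorem continuous_stepDeriv : Continuous stepDeriv :=
  continuous_iff_continuousAt.2 fun s => (hasDerivAt_stepDeriv s).continuousAt

theorem continuous_jap : Continuous jap :=
  continuous_iff_continuousAt.2 fun s => (hasDerivAt_jap s).continuousAt

/-- The weight `step (t - √(1 + x²))`: close to `1` deep inside the light cone `|x| < t`, and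
integrably small outside of it. -/
def weight (t : ℝ) : ℝ →ᵇ ℝ :=
  BoundedContinuousFunction.ofNormedAddCommGroup (fun x => step (t - jap x))
    (continuous_step.comp (by have := continuous_jap; fun_prop)) 1
    fun x => by rw [Real.norm_of_nonneg (step_pos _).le]; exact step_le_one _

/-- The time derivative of `weight`. -/
def weightTime (t : ℝ) : ℝ →ᵇ ℝ :=
  BoundedContinuousFunction.ofNormedAddCommGroup (fun x => stepDeriv (t - jap x))
    (continuous_stepDeriv.comp (by have := continuous_jap; fun_prop)) 1
    fun x => by rw [Real.norm_of_nonneg (stepDeriv_pos _).le]; exact stepDeriv_le _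

/-- The space derivative of `weight`. -/
def weightSpace (t : ℝ) : ℝ →ᵇ ℝ :=
  BoundedContinuousFunction.ofNormedAddCommGroup
    (fun x => -(x * (1 + x ^ 2) ^ (-1 / 2 : ℝ)) * stepDeriv (t - jap x))
    (by
      have h1 := continuous_jap
      have h2 := continuous_stepDeriv
      have h3 : Continuous fun x : ℝ => (1 + x ^ 2) ^ (-1 / 2 : ℝ) :=
        continuous_iff_continuousAt.2 fun s => (hasDerivAt_one_add_sq_rpow _ s).continuousAt
      fun_prop) 1
    fun x => by
      rw [norm_mul, norm_neg, Real.norm_of_nonneg (stepDeriv_pos _).le]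
      exact mul_le_one₀ (abs_mul_rpow_lt_one x).le (stepDeriv_pos _).le (stepDeriv_le _)

theorem weight_pos (t x : ℝ) : 0 < weight t x := step_pos _

/-- The level sets of the weight move outwards at least at the speed of light. -/
theorem abs_weightSpace_le (t x : ℝ) : |weightSpace t x| ≤ weightTime t x := by
  change |-(x * (1 + x ^ 2) ^ (-1 / 2 : ℝ)) * stepDeriv (t - jap x)| ≤ stepDeriv (t - jap x)
  rw [abs_mul, abs_neg, abs_of_pos (stepDeriv_pos _)]
  exact mul_le_of_le_one_left (stepDeriv_pos _).le (abs_mul_rpow_lt_one x).le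

theorem weight_hasTemperateGrowth (t : ℝ) : Function.HasTemperateGrowth (weight t : ℝ → ℝ) := by
  have h := jap_hasTemperateGrowth
  exact step_hasTemperateGrowth.comp (by fun_prop : Function.HasTemperateGrowth fun x => t - jap x)

theorem hasDerivAt_weight_space (t x : ℝ) : HasDerivAt (weight t) (weightSpace t x) x := by
  have := (hasDerivAt_step (t - jap x)).comp x ((hasDerivAt_jap x).const_sub t)
  refine this.congr_deriv ?_
  change _ = -(x * (1 + x ^ 2) ^ (-1 / 2 : ℝ)) * stepDeriv (t - jap x)
  ring

theorem hasDerivAt_weight (t : ℝ) : HasDerivAt weight (weightTime t) t := by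
  rw [hasDerivAt_iff_isLittleO_nhds_zero]
  have h1 : (fun h : ℝ => weight (t + h) - weight t - h • weightTime t) =O[𝓝 0] fun h => h ^ 2 := by
    refine Asymptotics.IsBigO.of_bound (3 / 2) (.of_forall fun h => ?_)
    rw [Real.norm_of_nonneg (sq_nonneg h), BoundedContinuousFunction.norm_le (by positivity)]
    intro x
    have := abs_step_sub_le (t - jap x) h
    rw [sub_add_eq_add_sub] at this
    exact this
  exact h1.trans_isLittleO (by simpa using Asymptotics.isLittleO_pow_id (𝕜 := ℝ) (one_lt_two))

/-- The majorant has an integral proportional to `t`. -/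
theorem weight_le {t : ℝ} (ht : 1 ≤ t) (x : ℝ) : weight t x ≤ 3 * (1 + (x / t) ^ 2)⁻¹ := by
  have ht0 : 0 < t := by linarith
  change step (t - jap x) ≤ _
  have hx := abs_le_jap x
  have hxt : (x / t) ^ 2 = (|x| / t) ^ 2 := by rw [div_pow, div_pow, sq_abs]
  rw [hxt, ← div_eq_mul_inv, le_div_iff₀ (by positivity)]
  rcases le_total 0 (t - jap x) with h | h
  · have h1 : |x| / t ≤ 1 := by rw [div_le_one ht0]; linarith
    have h2 : (|x| / t) ^ 2 ≤ 1 := pow_le_one₀ (by positivity) h1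
    nlinarith [step_le_one (t - jap x), step_pos (t - jap x)]
  · have h0 := step_le_of_nonpos h
    set s := t - jap x
    have h1 : |x| / t ≤ 1 - s := by
      rw [div_le_iff₀ ht0]; nlinarith
    have h2 : (|x| / t) ^ 2 ≤ (1 - s) ^ 2 := pow_le_pow_left₀ (by positivity) h1 2
    have h3 : 1 + (|x| / t) ^ 2 ≤ 3 * (1 + s ^ 2) := by nlinarith [sq_nonneg (1 + s)]
    calc step s * (1 + (|x| / t) ^ 2) ≤ (1 + s ^ 2)⁻¹ * (3 * (1 + s ^ 2)) := by gcongr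
      _ = 3 := by field_simp

theorem integrable_weight_bound {t : ℝ} (ht : 1 ≤ t) :
    Integrable fun x : ℝ => 3 * (1 + (x / t) ^ 2)⁻¹ :=
  ((integrable_inv_one_add_sq.comp_div (by linarith : t ≠ 0))).const_mul 3

theorem integral_weight_bound {t : ℝ} (ht : 1 ≤ t) :
    ∫ x : ℝ, 3 * (1 + (x / t) ^ 2)⁻¹ = 3 * Real.pi * t := by
  rw [integral_const_mul, Measure.integral_comp_div (fun y : ℝ => (1 + y ^ 2)⁻¹) t,
    integral_univ_inv_one_add_sq, abs_of_pos (by linarith), smul_eq_mul]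
  ring

/-! ### The weighted energy -/

theorem inner_mulOp_self_nonneg {a : ℝ →ᵇ ℝ} (ha : ∀ x, 0 ≤ a x) (f : L2 N) :
    0 ≤ inner ℝ (mulOp a f) f := by
  rw [inner_mulOp]
  exact integral_nonneg fun x => mul_nonneg (ha x) real_inner_self_nonneg

theorem eq_zero_of_inner_mulOp_self_le {a : ℝ →ᵇ ℝ} (ha : ∀ x, 0 < a x) {f : L2 N}
    (h : inner ℝ (mulOp a f) f ≤ 0) : f = 0 := by
  have h0 : ∫ x, a x * inner ℝ (f x) (f x) = 0 := by
    rw [← inner_mulOp]; exact le_antisymm h (inner_mulOp_self_nonneg (fun x => (ha x).le) f)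
  rw [integral_eq_zero_iff_of_nonneg (fun x => mul_nonneg (ha x).le real_inner_self_nonneg)
    (integrable_inner_mul a f f)] at h0
  refine Lp.ext ?_
  filter_upwards [h0, Lp.coeFn_zero (Vec N) 2 (volume : Measure ℝ)] with x hx hz
  rw [hz]
  simpa [(ha x).ne'] using hx

theorem hasDerivWithinAt_inner_mulOp {a : ℝ → ℝ →ᵇ ℝ} {a' : ℝ →ᵇ ℝ} {g : ℝ → L2 N} {g' : L2 N}
    {s : Set ℝ} {t : ℝ} (ha : HasDerivAt a a' t) (hg : HasDerivWithinAt g g' s t) :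
    HasDerivWithinAt (fun t => inner ℝ (mulOp (a t) (g t)) (g t))
      (inner ℝ (mulOp a' (g t)) (g t) + 2 * inner ℝ (mulOp (a t) (g t)) g') s t := by
  have h1 : HasDerivWithinAt (fun t => mulOp (N := N) (a t)) (mulOp a') s t :=
    (mulOp (N := N)).hasFDerivAt.comp_hasDerivWithinAt t ha.hasDerivWithinAt
  refine ((h1.clm_apply hg).inner ℝ hg).congr_deriv ?_
  rw [inner_add_left, inner_mulOp_comm (a t) g']
  ring

/-- The weighted energy `∫ a (|η|² + |θ|² + m² |ζ|²)`; `ζ`, `η`, `θ` stand for `u`, `∂ₜ u`, `∂ₓ u`. -/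
def energy (m : ℝ) (a : ℝ →ᵇ ℝ) (ζ η θ : L2 N) : ℝ :=
  inner ℝ (mulOp a η) η + inner ℝ (mulOp a θ) θ + m ^ 2 * inner ℝ (mulOp a ζ) ζ

theorem energy_nonneg (m : ℝ) {a : ℝ →ᵇ ℝ} (ha : ∀ x, 0 ≤ a x) (ζ η θ : L2 N) :
    0 ≤ energy m a ζ η θ := by
  have := inner_mulOp_self_nonneg ha ζ
  have := inner_mulOp_self_nonneg ha η
  have := inner_mulOp_self_nonneg ha θ
  unfold energy; positivity

/-- A flux with density bounded by the growth rate of the weight is absorbed by that growth. -/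
theorem two_mul_inner_le_energy (m : ℝ) {a b : ℝ →ᵇ ℝ} (hab : ∀ x, |b x| ≤ a x) (ζ η θ : L2 N) :
    2 * inner ℝ (mulOp b η) θ ≤ energy m a ζ η θ := by
  have ha : ∀ x, 0 ≤ a x := fun x => (abs_nonneg _).trans (hab x)
  have h0 := inner_mulOp_self_nonneg ha ζ
  have h1 : 2 * inner ℝ (mulOp b η) θ ≤ inner ℝ (mulOp a η) η + inner ℝ (mulOp a θ) θ := by
    rw [inner_mulOp, inner_mulOp, inner_mulOp, ← integral_const_mul,
      ← integral_add (integrable_inner_mul a η η) (integrable_inner_mul a θ θ)]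
    refine integral_mono ((integrable_inner_mul b η θ).const_mul 2)
      ((integrable_inner_mul a η η).add (integrable_inner_mul a θ θ)) fun x => ?_
    simp only [real_inner_self_eq_norm_sq]
    have hi := abs_real_inner_le_norm (η x) (θ x)
    have h2 : b x * inner ℝ (η x) (θ x) ≤ a x * (‖η x‖ * ‖θ x‖) := by
      refine (le_abs_self _).trans ?_
      rw [abs_mul]
      exact mul_le_mul (hab x) hi (abs_nonneg _) (ha x)
    nlinarith [mul_nonneg (ha x) (sq_nonneg (‖η x‖ - ‖θ x‖))]
  have := mul_nonneg (sq_nonneg m) h0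
  unfold energy; linarith

theorem energy_le {m : ℝ} {a : ℝ →ᵇ ℝ} (ha : ∀ x, 0 ≤ a x) {W : ℝ → ℝ} (hW : Integrable W)
    (haW : ∀ x, a x ≤ W x) {b : ℝ} {ζ η θ : L2 N} (h : ∀ᵐ x, ‖ζ x‖ + ‖η x‖ + ‖θ x‖ ≤ b) :
    energy m a ζ η θ ≤ (2 + m ^ 2) * b ^ 2 * ∫ x, W x := by
  have key : ∀ f : L2 N, (∀ᵐ x, ‖f x‖ ≤ b) → inner ℝ (mulOp a f) f ≤ b ^ 2 * ∫ x, W x := by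
    intro f hf
    rw [inner_mulOp, ← integral_const_mul]
    refine integral_mono_ae (integrable_inner_mul a f f) (hW.const_mul _) ?_
    filter_upwards [hf] with x hx
    rw [real_inner_self_eq_norm_sq, mul_comm]
    exact mul_le_mul (pow_le_pow_left₀ (norm_nonneg _) hx 2) (haW x) (ha x) (sq_nonneg b)
  have k1 := key ζ (h.mono fun x hx => by linarith [norm_nonneg (η x), norm_nonneg (θ x)])
  have k2 := key η (h.mono fun x hx => by linarith [norm_nonneg (ζ x), norm_nonneg (θ x)])
  have k3 := key θ (h.mono fun x hx => by linarith [norm_nonneg (η x), norm_nonneg (ζ x)])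
  unfold energy
  nlinarith [mul_le_mul_of_nonneg_left k1 (sq_nonneg m)]

theorem IsCubic.exists_norm_le {F : Vec N × Vec N × Vec N → Vec N} (hF : IsCubic F) :
    ∃ C, 0 ≤ C ∧ ∀ ζ η θ : Vec N,
      ‖F (ζ, η, θ)‖ ≤ C * (‖ζ‖ + ‖η‖ + ‖θ‖) * (‖ζ‖ ^ 2 + ‖η‖ ^ 2 + ‖θ‖ ^ 2) := by
  obtain ⟨C, hC⟩ := hF.bound
  refine ⟨max C 0, le_max_right _ _, fun ζ η θ => ?_⟩
  have h := hC 0 (by norm_num) (fun i => i.elim0) ζ η θ (Or.inr (by norm_num))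
  simp only [iteratedFDeriv_zero_apply] at h
  set S := ‖ζ‖ ^ 2 + ‖η‖ ^ 2 + ‖θ‖ ^ 2 with hS
  have hS0 : 0 ≤ S := by positivity
  have e : S ^ ((3 - (0 : ℕ) : ℝ) / 2) = √S * S := by
    rw [Real.sqrt_eq_rpow, ← Real.rpow_add_one' hS0 (by norm_num)]; norm_num
  rw [e] at h
  have hsq : √S ≤ ‖ζ‖ + ‖η‖ + ‖θ‖ := by
    rw [Real.sqrt_le_iff]
    refine ⟨by positivity, ?_⟩
    nlinarith [mul_nonneg (norm_nonneg ζ) (norm_nonneg η), mul_nonneg (norm_nonneg ζ) (norm_nonneg θ),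
      mul_nonneg (norm_nonneg η) (norm_nonneg θ)]
  calc _ ≤ C * (√S * S) := h
    _ ≤ max C 0 * ((‖ζ‖ + ‖η‖ + ‖θ‖) * S) := by
      gcongr
      exact le_max_left _ _
    _ = _ := by ring

theorem IsCubic.map_zero {F : Vec N × Vec N × Vec N → Vec N} (hF : IsCubic F) : F 0 = 0 := by
  obtain ⟨C, -, h⟩ := hF.exists_norm_le
  have : F (0, 0, 0) = 0 := by simpa using h 0 0 0
  exact this

/-- The work done by the nonlinearity against the weighted velocity: one factor is bounded by
`a ≥ ‖η‖_∞`, another by `b`, and the remaining two are quadratic in the energy. -/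
theorem neg_inner_nemytskii_le {F : Vec N × Vec N × Vec N → Vec N} {C : ℝ} (hC : 0 ≤ C)
    (hF : ∀ ζ η θ : Vec N,
      ‖F (ζ, η, θ)‖ ≤ C * (‖ζ‖ + ‖η‖ + ‖θ‖) * (‖ζ‖ ^ 2 + ‖η‖ ^ 2 + ‖θ‖ ^ 2))
    {m : ℝ} (hm : 0 < m) {w : ℝ →ᵇ ℝ} (hw : ∀ x, 0 ≤ w x) {a b : ℝ} (ha : 0 ≤ a) (hb : 0 ≤ b)
    {ζ η θ : L2 N}
    (h1 : ∀ᵐ x, ‖η x‖ ≤ a) (h2 : ∀ᵐ x, ‖ζ x‖ + ‖η x‖ + ‖θ x‖ ≤ b) :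
    -inner ℝ (mulOp w η) (nemytskii F ζ η θ) ≤
      C * (1 + (m ^ 2)⁻¹) * a * b * energy m w ζ η θ := by
  have hn : ∀ᵐ x, ‖nemytskii F ζ η θ x‖ ≤ C * b * (‖ζ x‖ ^ 2 + ‖η x‖ ^ 2 + ‖θ x‖ ^ 2) := by
    rw [nemytskii]
    -- Outside the domain of `nemytskii` its value is `0`, and the bound is trivial.
    split_ifs with h
    · filter_upwards [h.coeFn_toLp, h2] with x hx hb
      rw [hx]
      refine (hF _ _ _).trans ?_
      gcongr
    · filter_upwards [Lp.coeFn_zero (Vec N) 2 (volume : Measure ℝ)] with x hx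
      rw [hx, Pi.zero_apply, norm_zero]
      positivity
  have hi := ((integrable_inner_mul w ζ ζ).add (integrable_inner_mul w η η)).add (integrable_inner_mul w θ θ)
  have key : -inner ℝ (mulOp w η) (nemytskii F ζ η θ) ≤ C * a * b *
      (inner ℝ (mulOp w ζ) ζ + inner ℝ (mulOp w η) η + inner ℝ (mulOp w θ) θ) := by
    rw [inner_mulOp, inner_mulOp, inner_mulOp, inner_mulOp, ← integral_neg,
      ← integral_add' (integrable_inner_mul w ζ ζ) (integrable_inner_mul w η η),
      ← integral_add' ((integrable_inner_mul w ζ ζ).add (integrable_inner_mul w η η))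
        (integrable_inner_mul w θ θ),
      ← integral_const_mul]
    refine integral_mono_ae (integrable_inner_mul w η _).neg (hi.const_mul _) ?_
    filter_upwards [h1, hn] with x ha' hn'
    simp only [Pi.add_apply, real_inner_self_eq_norm_sq]
    have hle : -inner ℝ (η x) (nemytskii F ζ η θ x) ≤ a * (C * b * (‖ζ x‖ ^ 2 + ‖η x‖ ^ 2 + ‖θ x‖ ^ 2)) :=
      (neg_le_abs _).trans ((abs_real_inner_le_norm _ _).trans
        (mul_le_mul ha' hn' (norm_nonneg _) ha))
    have := mul_le_mul_of_nonneg_left hle (hw x)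
    change -(w x * inner ℝ (η x) (nemytskii F ζ η θ x)) ≤
      C * a * b * (w x * ‖ζ x‖ ^ 2 + w x * ‖η x‖ ^ 2 + w x * ‖θ x‖ ^ 2)
    linarith
  refine key.trans ?_
  have p1 := inner_mulOp_self_nonneg hw ζ
  have p2 := inner_mulOp_self_nonneg hw η
  have p3 := inner_mulOp_self_nonneg hw θ
  have hle : inner ℝ (mulOp w ζ) ζ + inner ℝ (mulOp w η) η + inner ℝ (mulOp w θ) θ ≤
      (1 + (m ^ 2)⁻¹) * energy m w ζ η θ := by
    unfold energy
    have e : (m ^ 2)⁻¹ * (m ^ 2 * inner ℝ (mulOp w ζ) ζ) = inner ℝ (mulOp w ζ) ζ := by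
      field_simp
    have q : 0 ≤ (m ^ 2)⁻¹ * (inner ℝ (mulOp w η) η + inner ℝ (mulOp w θ) θ) := by positivity
    have q2 : 0 ≤ m ^ 2 * inner ℝ (mulOp w ζ) ζ := by positivity
    linarith
  calc _ ≤ C * a * b * ((1 + (m ^ 2)⁻¹) * energy m w ζ η θ) := by gcongr
    _ = _ := by ring

section Solution

variable {F : Vec N × Vec N × Vec N → Vec N} {m T : ℝ} {u : ℝ → Sobolev N 2}

/-- The energy of the curve `u` at time `t` with the weight of the light cone. -/
def solEnergy (m T : ℝ) (u : ℝ → Sobolev N 2) (t : ℝ) : ℝ :=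
  energy m (weight t) (der 0 (u t)) (der 0 (timeDeriv (Ici T) u t)) (der 1 (u t))

theorem solEnergy_nonneg (m T : ℝ) (u : ℝ → Sobolev N 2) (t : ℝ) : 0 ≤ solEnergy m T u t :=
  energy_nonneg m (fun x => (weight_pos t x).le) _ _ _

theorem IsSolution.hasDerivWithinAt_solEnergy (hu : IsSolution F m (Ici T) u) (hF : ContDiff ℝ 1 F)
    (h0 : F 0 = 0) {t : ℝ} (ht : T ≤ t) :
    HasDerivWithinAt (solEnergy m T u)
      (energy m (weightTime t) (der 0 (u t)) (der 0 (timeDeriv (Ici T) u t)) (der 1 (u t))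
        - 2 * inner ℝ (mulOp (weightSpace t) (der 0 (timeDeriv (Ici T) u t))) (der 1 (u t))
        + 2 * inner ℝ (mulOp (weight t) (der 0 (timeDeriv (Ici T) u t))) (forcing F (Ici T) u t))
      (Ici T) t := by
  have hw := hasDerivAt_weight t
  have d := ((hasDerivWithinAt_inner_mulOp hw (hu.hasDerivWithinAt_timeDeriv hF h0 ht)).add
    (hasDerivWithinAt_inner_mulOp hw (hu.hasDerivWithinAt_der_one ht))).add
    ((hasDerivWithinAt_inner_mulOp hw (hu.hasDerivWithinAt_der_zero ht)).const_mul (m ^ 2))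
  refine d.congr_deriv ?_
  have ibp := IsWeakDeriv.inner_mulOp_add (isWeakDeriv_der (timeDeriv (Ici T) u t) 0)
    (isWeakDeriv_der (u t) 1) (weight_hasTemperateGrowth t) (hasDerivAt_weight_space t)
  change inner ℝ (mulOp (weight t) (der 0 (timeDeriv (Ici T) u t))) (der 2 (u t)) +
    inner ℝ (mulOp (weight t) (der 1 (u t))) (der 1 (timeDeriv (Ici T) u t)) =
    -inner ℝ (mulOp (weightSpace t) (der 0 (timeDeriv (Ici T) u t))) (der 1 (u t)) at ibp
  rw [inner_add_right, inner_sub_right, real_inner_smul_right,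
    inner_mulOp_comm _ (der 0 (timeDeriv (Ici T) u t)) (der 0 (u t))]
  unfold energy
  linear_combination 2 * ibp

/-- The localized energy inequality `E' ≥ -K ‖∂ₜ u‖_∞ (‖u‖_∞ + ‖∂ₜ u‖_∞ + ‖∂ₓ u‖_∞) E`. -/
theorem IsSolution.exists_solEnergy_deriv_ge (hu : IsSolution F m (Ici T) u) (hF : IsCubic F)
    (hm : 0 < m) : ∃ K, 0 ≤ K ∧ ∀ t ≥ T, ∀ a b : ℝ, 0 ≤ a → 0 ≤ b →
      (∀ᵐ x, ‖der 0 (timeDeriv (Ici T) u t) x‖ ≤ a) →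
      (∀ᵐ x, ‖der 0 (u t) x‖ + ‖der 0 (timeDeriv (Ici T) u t) x‖ + ‖der 1 (u t) x‖ ≤ b) →
      ∃ E', HasDerivWithinAt (solEnergy m T u) E' (Ici T) t ∧
        -(K * a * b * solEnergy m T u t) ≤ E' := by
  obtain ⟨C, hC, hb⟩ := hF.exists_norm_le
  refine ⟨2 * (C * (1 + (m ^ 2)⁻¹)), by positivity, fun t ht a b ha hb' h1 h2 => ⟨_,
    hu.hasDerivWithinAt_solEnergy (hF.contDiff.of_le (by norm_num)) hF.map_zero ht, ?_⟩⟩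
  have p1 := two_mul_inner_le_energy m (abs_weightSpace_le t) (der 0 (u t))
    (der 0 (timeDeriv (Ici T) u t)) (der 1 (u t))
  have p2 := neg_inner_nemytskii_le hC hb hm (fun x => (weight_pos t x).le) ha hb' h1 h2
  change -inner ℝ (mulOp (weight t) (der 0 (timeDeriv (Ici T) u t))) (forcing F (Ici T) u t) ≤
    C * (1 + (m ^ 2)⁻¹) * a * b * solEnergy m T u t at p2
  linarith

theorem eq_zero_of_solEnergy_le (hm : 0 < m) {t : ℝ} (h : solEnergy m T u t ≤ 0) : u t = 0 := by
  have p1 := inner_mulOp_self_nonneg (fun x => (weight_pos t x).le) (der 0 (u t))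
  have p2 := inner_mulOp_self_nonneg (fun x => (weight_pos t x).le) (der 0 (timeDeriv (Ici T) u t))
  have p3 := inner_mulOp_self_nonneg (fun x => (weight_pos t x).le) (der 1 (u t))
  unfold solEnergy energy at h
  have e0 : der 0 (u t) = 0 := by
    refine eq_zero_of_inner_mulOp_self_le (weight_pos t) ?_
    have hm2 : 0 < m ^ 2 := by positivity
    by_contra! hc
    have := mul_pos hm2 hc
    linarith
  have e1 : der 1 (u t) = 0 := by
    have := isWeakDeriv_der (u t) 0
    rw [show der (Fin.castSucc 0) (u t) = 0 from e0] at this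
    exact this.eq_zero
  have e2 : der 2 (u t) = 0 := by
    have := isWeakDeriv_der (u t) 1
    rw [show der (Fin.castSucc 1) (u t) = 0 from e1] at this
    exact this.eq_zero
  refine Subtype.ext (PiLp.ext fun i => ?_)
  fin_cases i
  exacts [e0, e1, e2]

end Solution

/-- Gronwall's inequality for `E' ≥ -k E`, with `Φ` a primitive of `k`. -/
theorem monotoneOn_mul_exp {E Φ k : ℝ → ℝ} {T t₀ t₁ : ℝ} (hT : T ≤ t₀)
    (hE : ∀ t ∈ Icc t₀ t₁, ∃ E', HasDerivWithinAt E E' (Ici T) t ∧ -(k t * E t) ≤ E')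
    (hΦ : ∀ t ∈ Icc t₀ t₁, HasDerivAt Φ (k t) t) :
    MonotoneOn (fun t => E t * Real.exp (Φ t)) (Icc t₀ t₁) := by
  choose! E' hE' hle using hE
  refine monotoneOn_of_hasDerivWithinAt_nonneg
    (f' := fun t => E' t * Real.exp (Φ t) + E t * (Real.exp (Φ t) * k t))
    (convex_Icc _ _) ?_ ?_ ?_
  · intro t ht
    exact (((hE' t ht).mono (fun s hs => hT.trans hs.1)).continuousWithinAt).mul
      (hΦ t ht).exp.continuousAt.continuousWithinAt
  · intro t ht
    have ht' := interior_subset ht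
    exact ((hE' t ht').mono (fun s hs => hT.trans (interior_subset hs).1)).mul (hΦ t ht').exp.hasDerivWithinAt
  · intro t ht
    have := hle t (interior_subset ht)
    have h2 : 0 ≤ (E' t + k t * E t) * Real.exp (Φ t) := mul_nonneg (by linarith) (Real.exp_pos _).le
    linarith

theorem ae_norm_le_of_supNorm_le {f : L2 N} {r : ℝ} (hr : 0 ≤ r)
    (h : supNorm f ≤ ENNReal.ofReal r) :
    ∀ᵐ x, ‖f x‖ ≤ r := by
  rw [supNorm, eLpNorm_exponent_top] at h
  filter_upwards [enorm_ae_le_eLpNormEssSup f volume] with x hx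
  have := hx.trans h
  rwa [← ofReal_norm, ENNReal.ofReal_le_ofReal_iff hr] at this

/-! ### Decay and vanishing -/

variable {F : Vec N × Vec N × Vec N → Vec N} {m T : ℝ} {u : ℝ → Sobolev N 2}

/-- Backward uniqueness: vanishing energy propagates to earlier times. -/
theorem IsSolution.solEnergy_nonpos_of_le (hu : IsSolution F m (Ici T) u) (hF : IsCubic F)
    (hm : 0 < m) {t t₁ : ℝ} (ht : T ≤ t) (htt : t ≤ t₁) (h : solEnergy m T u t₁ ≤ 0) :
    solEnergy m T u t ≤ 0 := by
  obtain ⟨K, hK, hd⟩ := hu.exists_solEnergy_deriv_ge hF hm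
  obtain ⟨M, hM, hb⟩ := hu.exists_ae_norm_le t₁
  have hmono := monotoneOn_mul_exp (E := solEnergy m T u) (Φ := fun t => K * M * (3 * M) * t)
    (k := fun _ => K * M * (3 * M)) (t₁ := t₁) ht (fun s hs => ?_)
    (fun s _ => by simpa using (hasDerivAt_id s).const_mul (K * M * (3 * M)))
  · have h1 := hmono (left_mem_Icc.2 htt) (right_mem_Icc.2 htt) htt
    have h2 : solEnergy m T u t₁ * Real.exp (K * M * (3 * M) * t₁) ≤ 0 :=
      mul_nonpos_of_nonpos_of_nonneg h (Real.exp_pos _).le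
    exact nonpos_of_mul_nonpos_left (h1.trans h2) (Real.exp_pos _)
  · obtain ⟨b0, b1, b2⟩ := hb s ⟨ht.trans hs.1, hs.2⟩
    refine hd s (ht.trans hs.1) M (3 * M) hM (by positivity) b2 ?_
    filter_upwards [b0, b1, b2] with x c0 c1 c2
    linarith

/-- If the constants of the decay are such that the energy loses at most a factor `(log t)^{1/2}`, then
it vanishes, because the decay forces it below a multiple of `(log t)⁻¹`. -/
theorem solEnergy_nonpos_of_decay {K C ε T₂ : ℝ} (hT₂ : 1 < T₂) (hTT₂ : T ≤ T₂)
    (hd : ∀ t ≥ T, ∀ a b : ℝ, 0 ≤ a → 0 ≤ b →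
      (∀ᵐ x, ‖der 0 (timeDeriv (Ici T) u t) x‖ ≤ a) →
      (∀ᵐ x, ‖der 0 (u t) x‖ + ‖der 0 (timeDeriv (Ici T) u t) x‖ + ‖der 1 (u t) x‖ ≤ b) →
      ∃ E', HasDerivWithinAt (solEnergy m T u) E' (Ici T) t ∧
        -(K * a * b * solEnergy m T u t) ≤ E')
    (hC : 0 ≤ C) (hε : 0 ≤ ε) (hKε : K * ε * (2 * C + ε) ≤ 1 / 2)
    (hu0 : ∀ t ≥ T₂, ∀ᵐ x, ‖der 0 (u t) x‖ ≤ C * (√(t * Real.log t))⁻¹)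
    (hu1 : ∀ t ≥ T₂, ∀ᵐ x, ‖der 1 (u t) x‖ ≤ C * (√(t * Real.log t))⁻¹)
    (hut : ∀ t ≥ T₂, ∀ᵐ x, ‖der 0 (timeDeriv (Ici T) u t) x‖ ≤ ε * (√(t * Real.log t))⁻¹) :
    solEnergy m T u T₂ ≤ 0 := by
  have hpos : ∀ t ≥ T₂, 0 < t * Real.log t := fun t ht =>
    mul_pos (by linarith) (Real.log_pos (by linarith))
  have hsum : ∀ t ≥ T₂, ∀ᵐ x, ‖der 0 (u t) x‖ + ‖der 0 (timeDeriv (Ici T) u t) x‖ + ‖der 1 (u t) x‖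
      ≤ (2 * C + ε) * (√(t * Real.log t))⁻¹ := fun t ht => by
    filter_upwards [hu0 t ht, hu1 t ht, hut t ht] with x h0 h1 h2
    linarith
  have hmono : ∀ t ≥ T₂, solEnergy m T u T₂ * Real.exp (1 / 2 * Real.log (Real.log T₂)) ≤
      solEnergy m T u t * Real.exp (1 / 2 * Real.log (Real.log t)) := fun t ht => by
    refine monotoneOn_mul_exp (E := solEnergy m T u) (Φ := fun t => 1 / 2 * Real.log (Real.log t))
      (k := fun t => 1 / 2 * (t * Real.log t)⁻¹) (t₁ := t) hTT₂ (fun s hs => ?_) (fun s hs => ?_)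
      (left_mem_Icc.2 ht) (right_mem_Icc.2 ht) ht
    · have hp := hpos s hs.1
      obtain ⟨E', h1, h2⟩ := hd s (hTT₂.trans hs.1) _ _ (by positivity) (by positivity)
        (hut s hs.1) (hsum s hs.1)
      refine ⟨E', h1, le_trans (neg_le_neg ?_) h2⟩
      refine mul_le_mul_of_nonneg_right ?_ (solEnergy_nonneg _ _ _ _)
      · have e : (√(s * Real.log s))⁻¹ * (√(s * Real.log s))⁻¹ = (s * Real.log s)⁻¹ := by
          rw [← mul_inv, Real.mul_self_sqrt hp.le]
        calc _ = K * ε * (2 * C + ε) * ((√(s * Real.log s))⁻¹ * (√(s * Real.log s))⁻¹) := by ring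
          _ ≤ _ := by rw [e]; gcongr
    · have hs1 : 1 < s := hT₂.trans_le hs.1
      have hl := Real.log_pos hs1
      refine (((Real.hasDerivAt_log (by linarith)).log hl.ne').const_mul (1 / 2)).congr_deriv ?_
      rw [mul_inv]; rfl
  have hup : ∀ t ≥ T₂, solEnergy m T u T₂ * Real.exp (1 / 2 * Real.log (Real.log T₂)) ≤
      (2 + m ^ 2) * (2 * C + ε) ^ 2 * (3 * Real.pi) * Real.exp (-(1 / 2 * Real.log (Real.log t))) := by
    intro t ht
    have ht1 : 1 < t := hT₂.trans_le ht
    have hl := Real.log_pos ht1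
    have he := energy_le (m := m) (fun x => (weight_pos t x).le) (integrable_weight_bound ht1.le)
      (weight_le ht1.le) (hsum t ht)
    rw [integral_weight_bound ht1.le, mul_pow, inv_pow, Real.sq_sqrt (hpos t ht).le] at he
    refine (hmono t ht).trans ?_
    calc _ ≤ ((2 + m ^ 2) * ((2 * C + ε) ^ 2 * (t * Real.log t)⁻¹) * (3 * Real.pi * t)) *
          Real.exp (1 / 2 * Real.log (Real.log t)) := by
          gcongr; exact he
      _ = (2 + m ^ 2) * (2 * C + ε) ^ 2 * (3 * Real.pi) * ((Real.log t)⁻¹ *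
          Real.exp (1 / 2 * Real.log (Real.log t))) := by field_simp
      _ = _ := by
        congr 1
        nth_rw 1 [← Real.exp_log hl]
        rw [← Real.exp_neg, ← Real.exp_add]
        congr 1; ring
  have hlim : Tendsto (fun t => (2 + m ^ 2) * (2 * C + ε) ^ 2 * (3 * Real.pi) *
      Real.exp (-(1 / 2 * Real.log (Real.log t)))) atTop (𝓝 0) := by
    have h1 : Tendsto (fun t => 1 / 2 * Real.log (Real.log t)) atTop atTop :=
      (Real.tendsto_log_atTop.comp Real.tendsto_log_atTop).const_mul_atTop (by norm_num)
    simpa using (Real.tendsto_exp_neg_atTop_nhds_zero.comp h1).const_mul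
      ((2 + m ^ 2) * (2 * C + ε) ^ 2 * (3 * Real.pi))
  have hle := ge_of_tendsto hlim (eventually_ge_atTop T₂ |>.mono hup)
  exact nonpos_of_mul_nonpos_left hle (Real.exp_pos _)

theorem rpow_mul_log_rpow {t : ℝ} (ht : 1 < t) (c : ℝ) :
    c * t ^ (-(1 / 2) : ℝ) * (Real.log t) ^ (-(1 / 2) : ℝ) = c * (√(t * Real.log t))⁻¹ := by
  have hl := Real.log_pos ht
  rw [mul_assoc, ← Real.mul_rpow (by linarith) hl.le, Real.rpow_neg (by positivity),
    ← Real.sqrt_eq_rpow]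

end KleinGordon

end

theorem theorem2 (N : ℕ) (m : ℝ) (hm : 0 < m)
    (F : KleinGordon.Vec N × KleinGordon.Vec N × KleinGordon.Vec N → KleinGordon.Vec N)
    (hF : KleinGordon.IsCubic F)
    (T : ℝ) (u : ℝ → KleinGordon.Sobolev N 2)
    (hu : KleinGordon.IsSolution F m (Set.Ici T) u)
    (C T₁ : ℝ) (hC : 0 < C) (hT₁ : 1 < T₁) (hTT₁ : T ≤ T₁)
    (hdecay : ∀ t ≥ T₁,
      KleinGordon.supNorm (KleinGordon.der 0 (u t)) + KleinGordon.supNorm (KleinGordon.der 1 (u t))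
        ≤ ENNReal.ofReal (C * t ^ (-(1 / 2) : ℝ) * (Real.log t) ^ (-(1 / 2) : ℝ)))
    (hdecay_t : ∀ ε > 0, ∃ T₂ ≥ T₁, ∀ t ≥ T₂,
      KleinGordon.supNorm (KleinGordon.der 0 (KleinGordon.timeDeriv (Set.Ici T) u t))
        ≤ ENNReal.ofReal (ε * t ^ (-(1 / 2) : ℝ) * (Real.log t) ^ (-(1 / 2) : ℝ))) :
    ∀ t ∈ Set.Ici T, u t = 0 := by
  obtain ⟨K, hK, hd⟩ := hu.exists_solEnergy_deriv_ge hF hm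
  -- `ε` is so small that the energy cannot lose more than a factor `(log t)^{1/2}`.
  set ε : ℝ := (2 * (K + 1) * (2 * C + 1))⁻¹ with hεdef
  have hε : 0 < ε := by positivity
  have hε1 : ε ≤ 1 := inv_le_one_of_one_le₀ (by nlinarith [mul_nonneg hK hC.le])
  have hKε : K * ε * (2 * C + ε) ≤ 1 / 2 := by
    have h1 : (K + 1) * ε * (2 * C + 1) = 1 / 2 := by rw [hεdef]; field_simp
    calc K * ε * (2 * C + ε) ≤ (K + 1) * ε * (2 * C + 1) := by gcongr; linarith
      _ = 1 / 2 := h1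
  obtain ⟨T₂, hT₂, ht⟩ := hdecay_t ε hε
  have hzero : ∀ s ≥ T₂, KleinGordon.solEnergy m T u s ≤ 0 := fun s hs => by
    have hgt : ∀ t ≥ s, 1 < t := fun t hts => by linarith
    refine KleinGordon.solEnergy_nonpos_of_decay (C := C) (hgt s le_rfl) (by linarith) hd hC.le hε.le hKε
      (fun t hts => ?_) (fun t hts => ?_) (fun t hts => ?_)
    · have h := hdecay t (by linarith)
      rw [KleinGordon.rpow_mul_log_rpow (hgt t hts)] at h
      exact KleinGordon.ae_norm_le_of_supNorm_le (by positivity) (le_self_add.trans h)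
    · have h := hdecay t (by linarith)
      rw [KleinGordon.rpow_mul_log_rpow (hgt t hts)] at h
      exact KleinGordon.ae_norm_le_of_supNorm_le (by positivity) (le_add_self.trans h)
    · have h := ht t (by linarith)
      rw [KleinGordon.rpow_mul_log_rpow (hgt t hts)] at h
      exact KleinGordon.ae_norm_le_of_supNorm_le (by positivity) h
  intro t htT
  have htT' : T ≤ t := htT
  exact KleinGordon.eq_zero_of_solEnergy_le hm (hu.solEnergy_nonpos_of_le hF hm htT'
    (le_max_left t T₂) (hzero _ (le_max_right t T₂)))
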